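/- Let $n\ge 0$ be an integer and let $U\subset\mathbb{R}^{n+1}$ be a bounded open convex domain whose boundary $\partial U$ is a $C^3$ hypersurface with positive normal curvatures (with respect to the inner normal; if $n=0$ this says nothing). For distinct $p,q\in U$ let $p_1$ and $q_1$ be the points at which the half-lines $p+\mathbb{R}_-(q-p)$ and $p+\mathbb{R}_+(q-p)$ meet $\partial U$, and let $$d_U(p,q)=\frac12\ln\left(\frac{\|q-p_1\|}{\|q-q_1\|}\cdot\frac{\|p-q_1\|}{\|p-p_1\|}\right),\qquad d_U(p,p)=0,$$ be the Hilbert distance of $U$. Fix a point $o\in U$ and for $t>0$ let $S_t^n=\{p\in U: d_U(o,p)=t\}$ be the metric sphere of radius $t$ about $o$. Let $\mathbf{Vol}$ be the $n$-dimensional (outer) Hausdorff measure with respect to $d_U$, that is, $$\mathbf{Vol}(A)=\lim_{r\to0}\ \mathbf{Vol}_E(\mathbb{B}^n)\,\inf\Big\{\sum_i\rho_i^n\Big\},$$ where the infimum is over all countable coverings of $A$ by closed $d_U$-balls with centres in $A$ and radii $\rho_i>0$ such that $2\rho_i<r$, and $\mathbf{Vol}_E(\mathbb{B}^n)$ is the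 Euclidean volume of the unit ball of $\mathbb{R}^n$. Then $0<\mathbf{Vol}(S_t^n)<\infty$ for every $t>0$, and $$\lim_{t\to\infty}\frac{\ln\mathbf{Vol}(S_t^n)}{t}=n.$$ -/

import Mathlib

open Set Filter Topology MeasureTheory
open scoped ENNReal

noncomputable section

/-- The point at which the half-line `p + ℝ₊ v` leaves `U`. For a bounded open convex `U`, `p ∈ U`
and `v ≠ 0`, this is the unique point of that half-line on the boundary of `U`. -/
def exitPoint {n : ℕ} (U : Set (EuclideanSpace ℝ (Fin n))) (p v : EuclideanSpace ℝ (Fin n)) :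
    EuclideanSpace ℝ (Fin n) :=
  p + sSup {s : ℝ | 0 ≤ s ∧ p + s • v ∈ U} • v

open Classical in
/-- The Hilbert distance of `U`. For `p ≠ q` let `p₁` and `q₁` be the boundary points of `U` on the
half-lines `p + ℝ₋ (q - p)` and `p + ℝ₊ (q - p)`; the distance is half the logarithm of the
cross-ratio of `p₁, p, q, q₁`. -/
def hilbertDist {n : ℕ} (U : Set (EuclideanSpace ℝ (Fin n))) (p q : EuclideanSpace ℝ (Fin n)) : ℝ :=
  if p = q then 0
  else
    1 / 2 * Real.log
      (‖q - exitPoint U p (-(q - p))‖ / ‖q - exitPoint U p (q - p)‖ *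
        (‖p - exitPoint U p (q - p)‖ / ‖p - exitPoint U p (-(q - p))‖))

/-- The metric sphere of radius `t` about `o` in the Hilbert geometry `(U, d_U)`. -/
def hilbertSphere {n : ℕ} (U : Set (EuclideanSpace ℝ (Fin n))) (o : EuclideanSpace ℝ (Fin n))
    (t : ℝ) : Set (EuclideanSpace ℝ (Fin n)) :=
  {p | p ∈ U ∧ hilbertDist U o p = t}

/-- The infimum, over all countable coverings of `A` by closed `d`-balls centred at points of `A`
and of radii `ρᵢ` with `2 ρᵢ < r`, of `Vol_E(𝔹ⁿ) ∑ ρᵢⁿ`. Here `𝔹ⁿ` is the Euclidean unit ball of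
`ℝⁿ`; an element `(x, ρ)` of the set `c` stands for the ball of centre `x` and radius `ρ`. -/
def hausdorffContent {X : Type*} (d : X → X → ℝ) (n : ℕ) (r : ℝ) (A : Set X) : ℝ≥0∞ :=
  volume (Metric.ball (0 : EuclideanSpace ℝ (Fin n)) 1) *
    ⨅ (c : Set (X × ℝ)) (_ : c.Countable)
      (_ : ∀ b ∈ c, b.1 ∈ A ∧ 0 < b.2 ∧ 2 * b.2 < r)
      (_ : ∀ p ∈ A, ∃ b ∈ c, d b.1 p ≤ b.2),
      ∑' b : c, ENNReal.ofReal b.1.2 ^ n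

/-- The `n`-dimensional outer Hausdorff measure of `A` for the distance `d` restricted to `A`: the
limit of the contents as `r → 0`, that is their supremum, as they increase when `r` decreases. -/
def hausdorffVol {X : Type*} (d : X → X → ℝ) (n : ℕ) (A : Set X) : ℝ≥0∞ :=
  ⨆ (r : ℝ) (_ : 0 < r), hausdorffContent d n r A

/-- Near `x`, the set `U` is the sublevel set `{f < 0}` of the `C³` function `f`, whose
differential does not vanish at `x`. -/
structure IsC3DefiningFunctionAt {n : ℕ} (U : Set (EuclideanSpace ℝ (Fin n)))
    (f : EuclideanSpace ℝ (Fin n) → ℝ) (x : EuclideanSpace ℝ (Fin n)) : Prop where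
  contDiffAt : ContDiffAt ℝ 3 f x
  fderiv_ne_zero : fderiv ℝ f x ≠ 0
  mem_iff : ∀ᶠ y in 𝓝 x, y ∈ U ↔ f y < 0

/-- The Euclidean normal curvature at `x`, in the tangent direction `v`, of the level hypersurface
of `f` through `x`, with respect to the unit normal `-∇f / ‖∇f‖` (which points into `{f < 0}`):
the second fundamental form divided by the first. -/
def normalCurvature {n : ℕ} (f : EuclideanSpace ℝ (Fin n) → ℝ) (x v : EuclideanSpace ℝ (Fin n)) :
    ℝ :=
  fderiv ℝ (fderiv ℝ f) x v v / (‖fderiv ℝ f x‖ * ‖v‖ ^ 2)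

/-- The boundary of `U` is a `C³` hypersurface all of whose normal curvatures, with respect to the
inner normal, are positive. (The tangent space at `x` is the kernel of the differential of a
defining function, and the normal curvatures do not depend on the choice of that function.) -/
def HasC3PositivelyCurvedBoundary {n : ℕ} (U : Set (EuclideanSpace ℝ (Fin n))) : Prop :=
  ∀ x ∈ frontier U, ∃ f : EuclideanSpace ℝ (Fin n) → ℝ, IsC3DefiningFunctionAt U f x ∧
    ∀ v : EuclideanSpace ℝ (Fin n), v ≠ 0 → fderiv ℝ f x v = 0 → 0 < normalCurvature f x v

end

/-!
The proof compares the Hilbert metric on the sphere of radius `t` with the Euclidean metric: up to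
constants independent of `t` they differ by the factor `eᵗ`, so that the volume of the sphere is
`eⁿᵗ` up to bounded factors.

Write `N_x` for the gauge of `U` at `x` (`gaugeAt`). Then
`d_U(x, x + v) = ½ log ((1 + N_x (-v)) / (1 - N_x v))` (`hilbertDist_eq`), so that at small distances
`d_U(x, x + v)` is comparable with `max (N_x v) (N_x (-v))`, and the sphere of radius `t` about `o` is
the level set `N_o v + ε N_o (-v) = 1 - ε` with `ε = e⁻²ᵗ` (`hilbertSphere_eq_gaugeSphere`). Its
points have depth of order `ε` in `U`. The `C³` boundary of positive curvature enters only through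
a pinching at each boundary point `p` by a functional `l` and uniform constants,
`k ‖p - q‖² ≤ l (p - q)` for `q ∈ U` and `l (p - q) ≤ K ‖p - q‖²` for `q ∉ U`
(`exists_isPinchedSupportAt_of_hasC3PositivelyCurvedBoundary`). This follows from Taylor's formula for
the defining functions and compactness of the boundary.

* Lower bound. By the first inequality a chord of `U` with midpoint at depth `O(ε)` has length
  `O(√ε)` (`IsPinchedDomain.mul_norm_sq_le_of_add_mem_of_sub_mem`). Hence a `d_U`-ball of small radius
  `ρ` about a point of the sphere meets the sphere in a set of Euclidean size `O(e⁻ᵗ ρ)`. The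
  orthogonal projection of the sphere to a coordinate hyperplane contains a fixed ball, and the
  projections of the balls of a covering must fill it
  (`IsPinchedDomain.volume_ball_le_mul_hausdorffVol`).
* Upper bound. By the second inequality, and because the sphere is almost parallel to the boundary,
  the chord through two nearby points of the sphere extends by a multiple of `√ε` on both sides
  (`IsPinchedDomain.exists_add_smul_mem`), so that `d_U` is `O(eᵗ)` times the Euclidean distance there.
  The sphere is a uniformly Lipschitz image of the boundary of a cube, so it has Euclidean
  `O(1 / m)`-nets of `O(mⁿ)` points, which give efficient coverings
  (`IsPinchedDomain.hausdorffVol_gaugeSphere_le`).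
-/

/-! ### Second order estimates -/

/-- A quadratic form that is positive on the kernel of a linear functional becomes positive
definite after adding a large multiple of the square of that functional. -/
theorem exists_le_quadratic_add_mul_sq {E : Type*} [NormedAddCommGroup E] [NormedSpace ℝ E]
    [FiniteDimensional ℝ E] (B : E →L[ℝ] E →L[ℝ] ℝ) (l : E →L[ℝ] ℝ)
    (h : ∀ v, v ≠ 0 → l v = 0 → 0 < B v v) :
    ∃ A κ : ℝ, 0 ≤ A ∧ 0 < κ ∧ ∀ v, κ * ‖v‖ ^ 2 ≤ B v v + A * l v ^ 2 := by
  have hcont : ∀ A : ℝ, Continuous fun v => B v v + A * l v ^ 2 := fun A => by fun_prop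
  have hS : IsCompact (Metric.sphere (0 : E) 1) := isCompact_sphere 0 1
  obtain ⟨m, hm⟩ := hS.elim_directed_cover
    (fun m : ℕ => {v | 0 < B v v + (m : ℝ) * l v ^ 2})
    (fun m => isOpen_lt continuous_const (hcont m))
    (fun v hv => by
      have hv0 : v ≠ 0 := by
        rintro rfl
        simp at hv
      simp only [mem_iUnion, mem_ofPred_eq]
      by_cases hl : l v = 0
      · exact ⟨0, by simpa [hl] using h v hv0 hl⟩
      · have hl2 : 0 < l v ^ 2 := by positivity
        obtain ⟨m, hm⟩ := exists_nat_gt (-B v v / l v ^ 2)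
        refine ⟨m, ?_⟩
        rw [div_lt_iff₀ hl2] at hm
        linarith)
    (directed_of_isDirected_le fun i j hij v hv => by
      simp only [mem_ofPred_eq] at hv ⊢
      have : (i : ℝ) ≤ j := by exact_mod_cast hij
      nlinarith [sq_nonneg (l v)])
  obtain ⟨κ, hκ, hmin⟩ : ∃ κ : ℝ, 0 < κ ∧
      ∀ v ∈ Metric.sphere (0 : E) 1, κ ≤ B v v + (m : ℝ) * l v ^ 2 := by
    rcases (Metric.sphere (0 : E) 1).eq_empty_or_nonempty with he | hne
    · exact ⟨1, one_pos, by simp [he]⟩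
    · obtain ⟨u, hu, hu'⟩ := hS.exists_isMinOn hne (hcont m).continuousOn
      exact ⟨_, hm hu, fun v hv => hu' hv⟩
  refine ⟨m, κ, Nat.cast_nonneg m, hκ, fun v => ?_⟩
  by_cases hv : v = 0
  · simp [hv]
  have hv' : 0 < ‖v‖ := norm_pos_iff.mpr hv
  have := hmin (‖v‖⁻¹ • v) (by simp [norm_smul, hv'.ne'])
  simp only [map_smul, smul_eq_mul, _root_.smul_apply] at this
  have h2 : ‖v‖⁻¹ * (‖v‖⁻¹ * B v v) + (m : ℝ) * (‖v‖⁻¹ * l v) ^ 2 =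
      (B v v + (m : ℝ) * l v ^ 2) / ‖v‖ ^ 2 := by
    field_simp
  rw [h2, le_div_iff₀ (by positivity)] at this
  exact this

/-- Second order Taylor lower bound along a unit-time path. -/
theorem add_deriv_add_half_le_of_le_deriv2 {g g' g'' : ℝ → ℝ} {m : ℝ}
    (hg : ∀ s ∈ Icc (0 : ℝ) 1, HasDerivAt g (g' s) s)
    (hg' : ∀ s ∈ Icc (0 : ℝ) 1, HasDerivAt g' (g'' s) s)
    (hm : ∀ s ∈ Icc (0 : ℝ) 1, m ≤ g'' s) : g 0 + g' 0 + m / 2 ≤ g 1 := by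
  have hint : interior (Icc (0 : ℝ) 1) ⊆ Icc 0 1 := interior_subset
  have hd1 : ∀ s ∈ Icc (0 : ℝ) 1, HasDerivAt (fun s => g' s - m * s) (g'' s - m) s := fun s hs =>
    ((hg' s hs).sub ((hasDerivAt_id s).const_mul m)).congr_deriv (by simp)
  have h1 : MonotoneOn (fun s => g' s - m * s) (Icc 0 1) :=
    monotoneOn_of_deriv_nonneg (convex_Icc 0 1)
      (fun s hs => (hd1 s hs).continuousAt.continuousWithinAt)
      (fun s hs => (hd1 s (hint hs)).differentiableAt.differentiableWithinAt)
      (fun s hs => by rw [(hd1 s (hint hs)).deriv]; linarith [hm s (hint hs)])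
  have hd2 : ∀ s ∈ Icc (0 : ℝ) 1,
      HasDerivAt (fun s => g s - g' 0 * s - m / 2 * s ^ 2) (g' s - g' 0 - m * s) s := fun s hs => by
    have := ((hg s hs).sub ((hasDerivAt_id s).const_mul (g' 0))).sub
      (((hasDerivAt_id s).pow 2).const_mul (m / 2))
    refine this.congr_deriv ?_
    simp
    ring
  have h2 : MonotoneOn (fun s => g s - g' 0 * s - m / 2 * s ^ 2) (Icc 0 1) :=
    monotoneOn_of_deriv_nonneg (convex_Icc 0 1)
      (fun s hs => (hd2 s hs).continuousAt.continuousWithinAt)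
      (fun s hs => (hd2 s (hint hs)).differentiableAt.differentiableWithinAt)
      (fun s hs => by
        rw [(hd2 s (hint hs)).deriv]
        have := h1 (left_mem_Icc.mpr zero_le_one) (hint hs) (hint hs).1
        simp only at this
        linarith)
  have := h2 (left_mem_Icc.mpr zero_le_one) (right_mem_Icc.mpr zero_le_one) zero_le_one
  simp only at this
  linarith

/-- Second order Taylor lower bound on a convex set, given a lower bound of the Hessian in the
direction `q - p`. -/
theorem add_fderiv_add_half_le {E : Type*} [NormedAddCommGroup E] [NormedSpace ℝ E] {f : E → ℝ}
    {s : Set E} (hs : Convex ℝ s) (hf : ∀ y ∈ s, DifferentiableAt ℝ f y)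
    (hf' : ∀ y ∈ s, DifferentiableAt ℝ (fderiv ℝ f) y) {p q : E} (hp : p ∈ s) (hq : q ∈ s) {m : ℝ}
    (hm : ∀ y ∈ s, m ≤ fderiv ℝ (fderiv ℝ f) y (q - p) (q - p)) :
    f p + fderiv ℝ f p (q - p) + m / 2 ≤ f q := by
  have hmem : ∀ r ∈ Icc (0 : ℝ) 1, p + r • (q - p) ∈ s := fun r hr =>
    hs.add_smul_sub_mem hp hq hr
  have hline : ∀ r : ℝ, HasDerivAt (fun r : ℝ => p + r • (q - p)) (q - p) r := fun r => by
    simpa using ((hasDerivAt_id r).smul_const (q - p)).const_add p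
  have := add_deriv_add_half_le_of_le_deriv2 (g := fun r => f (p + r • (q - p)))
    (g' := fun r => fderiv ℝ f (p + r • (q - p)) (q - p))
    (g'' := fun r => fderiv ℝ (fderiv ℝ f) (p + r • (q - p)) (q - p) (q - p)) (m := m)
    (fun r hr => (hf _ (hmem r hr)).hasFDerivAt.comp_hasDerivAt r (hline r))
    (fun r hr => by
      have h := (hf' _ (hmem r hr)).hasFDerivAt.comp_hasDerivAt r (hline r)
      simpa using h.clm_apply (hasDerivAt_const r (q - p)))
    (fun r hr => hm _ (hmem r hr))
  simpa using this

/-- Second order Taylor upper bound on a convex set, given an upper bound of the Hessian in the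
direction `q - p`. -/
theorem le_add_fderiv_add_half {E : Type*} [NormedAddCommGroup E] [NormedSpace ℝ E] {f : E → ℝ}
    {s : Set E} (hs : Convex ℝ s) (hf : ∀ y ∈ s, DifferentiableAt ℝ f y)
    (hf' : ∀ y ∈ s, DifferentiableAt ℝ (fderiv ℝ f) y) {p q : E} (hp : p ∈ s) (hq : q ∈ s) {m : ℝ}
    (hm : ∀ y ∈ s, fderiv ℝ (fderiv ℝ f) y (q - p) (q - p) ≤ m) :
    f q ≤ f p + fderiv ℝ f p (q - p) + m / 2 := by
  have h1 : fderiv ℝ (-f) = -fderiv ℝ f := funext fun y => fderiv_neg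
  have h2 : fderiv ℝ (-fderiv ℝ f) = -fderiv ℝ (fderiv ℝ f) := funext fun y => fderiv_neg
  have := add_fderiv_add_half_le (f := -f) hs (fun y hy => (hf y hy).neg)
    (by rw [h1]; exact fun y hy => (hf' y hy).neg) hp hq (m := -m) (fun y hy => by
      rw [h1, h2]
      exact neg_le_neg (hm y hy))
  rw [h1] at this
  simp only [Pi.neg_apply, _root_.neg_apply] at this
  linarith

/-- The absorption step for convexity: `w` stands for minus the first derivative, whose square is the
price of the correction that made the Hessian positive definite. -/
theorem mul_le_of_le_add_mul_sq {A κ w s : ℝ} (hs : 0 ≤ s) (hκ : 0 ≤ κ)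
    (hAw : 2 * A * |w| ≤ 1) (h : κ / 4 * s ≤ w + A * w ^ 2) : κ / 6 * s ≤ w := by
  have h1 : 2 * A * |w| * |w| ≤ 1 * |w| := mul_le_mul_of_nonneg_right hAw (abs_nonneg w)
  have h2 : A * w ^ 2 ≤ |w| / 2 := by
    rw [← sq_abs w]
    linarith
  have h3 : 0 ≤ κ * s := mul_nonneg hκ hs
  rcases le_or_gt 0 w with h0 | h0
  · rw [abs_of_nonneg h0] at h2
    linarith
  · rw [abs_of_neg h0] at h2
    linarith

theorem apply_apply_le_of_norm_le {E : Type*} [NormedAddCommGroup E] [NormedSpace ℝ E]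
    {B : E →L[ℝ] E →L[ℝ] ℝ} {L : ℝ} (h : ‖B‖ ≤ L) (v : E) : B v v ≤ L * ‖v‖ ^ 2 :=
  calc B v v ≤ ‖B v v‖ := Real.le_norm_self _
    _ ≤ ‖B‖ * ‖v‖ * ‖v‖ := B.le_opNorm₂ v v
    _ ≤ L * ‖v‖ * ‖v‖ := by gcongr
    _ = L * ‖v‖ ^ 2 := by ring

/-- Positivity of `B + A l²` survives small changes of `B` and `l`, at the cost of constants. -/
theorem le_apply_apply_of_perturbation {E : Type*} [NormedAddCommGroup E] [NormedSpace ℝ E]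
    {B B₀ : E →L[ℝ] E →L[ℝ] ℝ} {l l₀ : E →L[ℝ] ℝ} {A κ : ℝ} {v : E} (hA : 0 ≤ A)
    (hpos : κ * ‖v‖ ^ 2 ≤ B₀ v v + A * l₀ v ^ 2) (hB : ‖B - B₀‖ ≤ κ / 4)
    (hl : 2 * A * ‖l - l₀‖ ^ 2 ≤ κ / 4) : κ / 2 * ‖v‖ ^ 2 - 2 * A * l v ^ 2 ≤ B v v := by
  have h1 : B₀ v v - B v v ≤ κ / 4 * ‖v‖ ^ 2 :=
    apply_apply_le_of_norm_le (B := B₀ - B) (((norm_sub_rev B B₀).symm.trans_le) hB) v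
  have h2 : (l v - l₀ v) ^ 2 ≤ (‖l - l₀‖ * ‖v‖) ^ 2 := by
    rw [← sq_abs]
    gcongr
    exact (l - l₀).le_opNorm v
  have h3 : l₀ v ^ 2 ≤ 2 * l v ^ 2 + 2 * (‖l - l₀‖ * ‖v‖) ^ 2 := by
    nlinarith [sq_nonneg (2 * l v - l₀ v)]
  have h4 := mul_le_mul_of_nonneg_left h3 hA
  have h5 := mul_le_mul_of_nonneg_right hl (sq_nonneg ‖v‖)
  rw [mul_pow] at h4
  linarith

/-! ### The boundary is pinched between tangent spheres -/

/-- The functional `l` supports `U` at `p` up to second order: on `U ∩ ball p η` the quantity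
`l (p - q)` is at least `k ‖p - q‖²`, and off `U` it is, in the same ball, at most `K ‖p - q‖²`.
Geometrically, near `p` the boundary of `U` lies between two spheres tangent to it at `p`. -/
structure IsPinchedSupportAt {E : Type*} [NormedAddCommGroup E] [NormedSpace ℝ E] (U : Set E)
    (p : E) (l : E →L[ℝ] ℝ) (η k K M : ℝ) : Prop where
  norm_le : ‖l‖ ≤ M
  lower : ∀ q ∈ U, ‖p - q‖ < η → k * ‖p - q‖ ^ 2 ≤ l (p - q)
  upper : ∀ q ∉ U, ‖p - q‖ < η → l (p - q) ≤ K * ‖p - q‖ ^ 2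

theorem IsPinchedSupportAt.mono {E : Type*} [NormedAddCommGroup E] [NormedSpace ℝ E] {U : Set E}
    {p : E} {l : E →L[ℝ] ℝ} {η k K M η' k' K' M' : ℝ} (h : IsPinchedSupportAt U p l η k K M)
    (hη : η' ≤ η) (hk : k' ≤ k) (hK : K ≤ K') (hM : M ≤ M') :
    IsPinchedSupportAt U p l η' k' K' M' where
  norm_le := h.norm_le.trans hM
  lower q hq hpq := (mul_le_mul_of_nonneg_right hk (sq_nonneg _)).trans
    (h.lower q hq (hpq.trans_le hη))
  upper q hq hpq := (h.upper q hq (hpq.trans_le hη)).trans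
    (mul_le_mul_of_nonneg_right hK (sq_nonneg _))

theorem apply_eq_zero_of_mem_frontier {E : Type*} [TopologicalSpace E] {U : Set E} (hU : IsOpen U)
    {f : E → ℝ} {p : E} (hp : p ∈ frontier U) (hf : ContinuousAt f p)
    (h : ∀ᶠ y in 𝓝 p, y ∈ U ↔ f y < 0) : f p = 0 := by
  rw [hU.frontier_eq] at hp
  apply le_antisymm
  · by_contra! hlt
    obtain ⟨y, hyU, hy1, hy2⟩ := ((mem_closure_iff_frequently.mp hp.1).and_eventually
      ((hf.eventually (lt_mem_nhds hlt)).and h)).exists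
    exact absurd (hy2.mp hyU) hy1.not_gt
  · exact not_lt.mp fun hlt => hp.2 (h.self_of_nhds.mpr hlt)

set_option maxHeartbeats 800000 in
/-- Near a boundary point of positive curvature the differential of a defining function pinches `U`
with uniform constants. -/
theorem exists_isPinchedSupportAt_nhds {n : ℕ} {U : Set (EuclideanSpace ℝ (Fin n))}
    (hU : IsOpen U) {f : EuclideanSpace ℝ (Fin n) → ℝ} {x : EuclideanSpace ℝ (Fin n)}
    (hf : IsC3DefiningFunctionAt U f x)
    (hcurv : ∀ v, v ≠ 0 → fderiv ℝ f x v = 0 → 0 < normalCurvature f x v) :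
    ∃ η k K M : ℝ, 0 < η ∧ 0 < k ∧ 0 < K ∧ 0 < M ∧
      ∀ p ∈ Metric.ball x η ∩ frontier U, ∃ l, IsPinchedSupportAt U p l η k K M := by
  have hne : 0 < ‖fderiv ℝ f x‖ := norm_pos_iff.mpr hf.fderiv_ne_zero
  obtain ⟨A, κ, hA, hκ, hpos⟩ := exists_le_quadratic_add_mul_sq (fderiv ℝ (fderiv ℝ f) x)
    (fderiv ℝ f x) (fun v hv hlv => by
      have := hcurv v hv hlv
      rw [normalCurvature] at this
      have hv' : 0 < ‖v‖ := norm_pos_iff.mpr hv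
      exact (div_pos_iff_of_pos_right (by positivity)).mp this)
  have hf1 : ∀ y, ContDiffAt ℝ 3 f y → ContDiffAt ℝ 2 (fderiv ℝ f) y := fun y hy =>
    hy.fderiv_right (by norm_num)
  have hf2 : ContDiffAt ℝ 1 (fderiv ℝ (fderiv ℝ f)) x :=
    (hf1 x hf.contDiffAt).fderiv_right (by norm_num)
  have e0 : ∀ᶠ y in 𝓝 x, ContDiffAt ℝ 3 f y := hf.contDiffAt.eventually (by simp)
  have e1 : ∀ᶠ y in 𝓝 x, ‖fderiv ℝ (fderiv ℝ f) y - fderiv ℝ (fderiv ℝ f) x‖ < κ / 4 := by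
    have : Tendsto (fun y => ‖fderiv ℝ (fderiv ℝ f) y - fderiv ℝ (fderiv ℝ f) x‖) (𝓝 x) (𝓝 0) := by
      exact tendsto_iff_norm_sub_tendsto_zero.mp hf2.continuousAt
    exact this.eventually (gt_mem_nhds (by positivity))
  have e2 : ∀ᶠ y in 𝓝 x, 2 * A * ‖fderiv ℝ f y - fderiv ℝ f x‖ ^ 2 < κ / 4 := by
    have : Tendsto (fun y => 2 * A * ‖fderiv ℝ f y - fderiv ℝ f x‖ ^ 2) (𝓝 x) (𝓝 0) := by
      simpa using ((tendsto_iff_norm_sub_tendsto_zero.mp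
        (hf1 x hf.contDiffAt).continuousAt).pow 2).const_mul (2 * A)
    exact this.eventually (gt_mem_nhds (by positivity))
  have e3 : ∀ᶠ y in 𝓝 x, ‖fderiv ℝ f y‖ < ‖fderiv ℝ f x‖ + 1 :=
    (hf1 x hf.contDiffAt).continuousAt.norm.eventually (gt_mem_nhds (by linarith))
  obtain ⟨r, hr, hball⟩ := Metric.eventually_nhds_iff_ball.mp
    (e0.and (e1.and (e2.and (e3.and hf.mem_iff))))
  set M := ‖fderiv ℝ f x‖ + 1 with hM
  set L := ‖fderiv ℝ (fderiv ℝ f) x‖ + κ / 4 with hL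
  have hL0 : 0 < L := by positivity
  have hM0 : 0 < M := by positivity
  -- The first bound keeps `ball p η` inside `ball x r`; the second makes `2 A |f' p v| ≤ 1` there.
  set η := min (r / 2) (1 / (2 * (A + 1) * M)) with hη
  have hη0 : 0 < η := by positivity
  have hη1 : η ≤ r / 2 := min_le_left _ _
  have hη2 : 2 * (A + 1) * M * η ≤ 1 := by
    have : η ≤ 1 / (2 * (A + 1) * M) := min_le_right _ _
    rwa [le_div_iff₀ (by positivity), mul_comm] at this
  refine ⟨η, κ / 6, L / 2, M, hη0, by positivity, by positivity, hM0, ?_⟩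
  rintro p ⟨hpx, hpf⟩
  rw [Metric.mem_ball] at hpx
  have hpr : p ∈ Metric.ball x r := by rw [Metric.mem_ball]; linarith
  have hqr : ∀ q, ‖p - q‖ < η → q ∈ Metric.ball x r := fun q hq => by
    rw [Metric.mem_ball]
    have := dist_triangle q p x
    rw [dist_comm q p, dist_eq_norm p q] at this
    linarith
  have hs : Convex ℝ (Metric.ball x r) := convex_ball x r
  have hfd : ∀ y ∈ Metric.ball x r, DifferentiableAt ℝ f y := fun y hy =>
    (hball y hy).1.differentiableAt (by norm_num)
  have hfd' : ∀ y ∈ Metric.ball x r, DifferentiableAt ℝ (fderiv ℝ f) y := fun y hy =>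
    (hf1 y (hball y hy).1).differentiableAt (by norm_num)
  have hfp : f p = 0 := apply_eq_zero_of_mem_frontier hU hpf (hfd p hpr).continuousAt
    (by filter_upwards [Metric.isOpen_ball.mem_nhds hpr] with y hy using (hball y hy).2.2.2.2)
  refine ⟨fderiv ℝ f p, (hball p hpr).2.2.2.1.le, fun q hq hpq => ?_, fun q hq hpq => ?_⟩
  · set v := q - p with hv
    have hvn : ‖p - q‖ = ‖v‖ := by rw [norm_sub_rev]
    have hlv : fderiv ℝ f p (p - q) = -fderiv ℝ f p v := by rw [← map_neg, hv, neg_sub]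
    rw [hvn] at hpq ⊢
    rw [hlv]
    set w := -fderiv ℝ f p v with hw
    have hT := add_fderiv_add_half_le hs hfd hfd' hpr (hqr q (by rwa [hvn]))
      (m := κ / 2 * ‖v‖ ^ 2 - 2 * A * w ^ 2) (fun y hy => by
        rw [hw, neg_sq]
        exact le_apply_apply_of_perturbation hA (hpos v) (hball y hy).2.1.le
          (hball p hpr).2.2.1.le)
    have hfq : f q < 0 := (hball q (hqr q (by rwa [hvn]))).2.2.2.2.mp hq
    rw [hfp, ← hv, show fderiv ℝ f p v = -w by rw [hw, neg_neg]] at hT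
    have hwn : |w| ≤ M * ‖v‖ := by
      rw [hw, abs_neg, ← Real.norm_eq_abs]
      exact (fderiv ℝ f p).le_of_opNorm_le (hball p hpr).2.2.2.1.le v
    have hAw : 2 * A * |w| ≤ 1 := by
      calc 2 * A * |w| ≤ 2 * (A + 1) * (M * η) := by
            gcongr
            · linarith
            · exact hwn.trans (by gcongr)
        _ ≤ 1 := by linarith
    exact mul_le_of_le_add_mul_sq (sq_nonneg _) hκ.le hAw (by linarith)
  · have hT := le_add_fderiv_add_half hs hfd hfd' hpr (hqr q hpq) (m := L * ‖p - q‖ ^ 2)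
      (fun y hy => by
        have h1 := norm_le_norm_add_norm_sub' (fderiv ℝ (fderiv ℝ f) y) (fderiv ℝ (fderiv ℝ f) x)
        have h2 : ‖fderiv ℝ (fderiv ℝ f) y‖ ≤ L := by linarith [(hball y hy).2.1]
        rw [norm_sub_rev p q]
        exact apply_apply_le_of_norm_le h2 (q - p))
    have hfq : 0 ≤ f q := by
      rw [(hball q (hqr q hpq)).2.2.2.2] at hq
      exact not_lt.mp hq
    have hlv : fderiv ℝ f p (q - p) = -fderiv ℝ f p (p - q) := by rw [← map_neg, neg_sub]
    rw [hfp, hlv] at hT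
    linarith

/-- A bounded open convex set with `C³` boundary of positive curvature is pinched, at every boundary
point, between two spheres whose radii do not depend on the point. -/
theorem exists_isPinchedSupportAt_of_hasC3PositivelyCurvedBoundary {n : ℕ}
    {U : Set (EuclideanSpace ℝ (Fin n))} (hU : IsOpen U) (hconv : Convex ℝ U)
    (hbdd : Bornology.IsBounded U) (hb : HasC3PositivelyCurvedBoundary U) :
    ∃ k K M : ℝ, 0 < k ∧ 0 < K ∧ 0 < M ∧ ∀ p ∈ frontier U, ∃ l : EuclideanSpace ℝ (Fin n) →L[ℝ] ℝ,
      ‖l‖ ≤ M ∧ (∀ q ∈ U, k * ‖p - q‖ ^ 2 ≤ l (p - q)) ∧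
        ∀ q ∉ U, l (p - q) ≤ K * ‖p - q‖ ^ 2 := by
  have hcpt : IsCompact (frontier U) :=
    Metric.isCompact_of_isClosed_isBounded isClosed_frontier
      (hbdd.closure.subset frontier_subset_closure)
  obtain ⟨η, k, K, M, hη, hk, hK, hM, hloc⟩ : ∃ η k K M : ℝ, 0 < η ∧ 0 < k ∧ 0 < K ∧ 0 < M ∧
      ∀ p ∈ frontier U ∩ frontier U, ∃ l, IsPinchedSupportAt U p l η k K M := by
    refine hcpt.induction_on
      (p := fun s => ∃ η k K M : ℝ, 0 < η ∧ 0 < k ∧ 0 < K ∧ 0 < M ∧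
        ∀ p ∈ s ∩ frontier U, ∃ l, IsPinchedSupportAt U p l η k K M)
      ⟨1, 1, 1, 1, one_pos, one_pos, one_pos, one_pos, by simp⟩ ?_ ?_ ?_
    · rintro s t hst ⟨η, k, K, M, hη, hk, hK, hM, h⟩
      exact ⟨η, k, K, M, hη, hk, hK, hM, fun p hp => h p ⟨hst hp.1, hp.2⟩⟩
    · rintro s t ⟨η, k, K, M, hη, hk, hK, hM, h⟩ ⟨η', k', K', M', hη', hk', hK', hM', h'⟩
      refine ⟨min η η', min k k', max K K', max M M', lt_min hη hη', lt_min hk hk',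
        lt_max_of_lt_left hK, lt_max_of_lt_left hM, ?_⟩
      rintro p ⟨hp | hp, hpf⟩
      · obtain ⟨l, hl⟩ := h p ⟨hp, hpf⟩
        exact ⟨l, hl.mono (min_le_left _ _) (min_le_left _ _) (le_max_left _ _) (le_max_left _ _)⟩
      · obtain ⟨l, hl⟩ := h' p ⟨hp, hpf⟩
        exact ⟨l, hl.mono (min_le_right _ _) (min_le_right _ _) (le_max_right _ _)
          (le_max_right _ _)⟩
    · intro x hx
      obtain ⟨f, hf, hcurv⟩ := hb x hx
      obtain ⟨η, k, K, M, hη, hk, hK, hM, h⟩ := exists_isPinchedSupportAt_nhds hU hf hcurv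
      exact ⟨Metric.ball x η, mem_nhdsWithin_of_mem_nhds (Metric.ball_mem_nhds x hη),
        η, k, K, M, hη, hk, hK, hM, h⟩
  obtain ⟨D, hD, hdiam⟩ : ∃ D : ℝ, 0 < D ∧ ∀ p ∈ closure U, ∀ q ∈ closure U, ‖p - q‖ ≤ D := by
    obtain ⟨D, hD⟩ := Metric.isBounded_iff.mp hbdd.closure
    exact ⟨max D 1, by positivity, fun p hp q hq => by
      rw [← dist_eq_norm]
      exact (hD hp hq).trans (le_max_left _ _)⟩
  refine ⟨min k (k * (η / 2) / D), max K (M / η), M, by positivity, by positivity, hM,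
    fun p hp => ?_⟩
  obtain ⟨l, hl⟩ := hloc p ⟨hp, hp⟩
  refine ⟨l, hl.norm_le, fun q hq => ?_, fun q hq => ?_⟩
  · rcases lt_or_ge ‖p - q‖ η with hlt | hge
    · exact (hl.mono le_rfl (min_le_left _ _) le_rfl le_rfl).lower q hq hlt
    · -- The point of the segment from `p` to `q` at distance `η / 2` from `p` lies in `U`.
      set s := ‖p - q‖ with hs
      have hs0 : 0 < s := hη.trans_le hge
      have hr0 : 0 < η / 2 / s := by positivity
      have hr1 : η / 2 / s < 1 := by
        rw [div_lt_one hs0]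
        linarith
      have hmem : p + (η / 2 / s) • (q - p) ∈ U := by
        have := hconv.add_smul_sub_mem_interior' (frontier_subset_closure hp)
          (by rwa [hU.interior_eq]) ⟨hr0, hr1.le⟩
        rwa [hU.interior_eq] at this
      have hsub : p - (p + (η / 2 / s) • (q - p)) = (η / 2 / s) • (p - q) := by
        rw [← neg_sub p q, smul_neg]
        abel
      have hnorm : ‖(η / 2 / s) • (p - q)‖ = η / 2 := by
        rw [norm_smul, Real.norm_of_nonneg hr0.le, ← hs]
        field_simp
      have := hl.lower _ hmem (by rw [hsub, hnorm]; linarith)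
      rw [hsub, hnorm, map_smul, smul_eq_mul] at this
      have h2 : k * (η / 2) * s ≤ l (p - q) := by
        rw [div_mul_eq_mul_div, le_div_iff₀ hs0] at this
        nlinarith
      have hsD : s ≤ D := hdiam p (frontier_subset_closure hp) q (subset_closure hq)
      calc min k (k * (η / 2) / D) * s ^ 2 ≤ k * (η / 2) / D * s ^ 2 := by
            gcongr
            exact min_le_right _ _
        _ = k * (η / 2) * s * (s / D) := by ring
        _ ≤ k * (η / 2) * s * 1 := by
            gcongr
            exact (div_le_one hD).mpr hsD
        _ ≤ l (p - q) := by linarith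
  · rcases lt_or_ge ‖p - q‖ η with hlt | hge
    · exact (hl.mono le_rfl le_rfl (le_max_left _ _) le_rfl).upper q hq hlt
    · calc l (p - q) ≤ M * ‖p - q‖ :=
            (Real.le_norm_self _).trans (l.le_of_opNorm_le hl.norm_le _)
        _ = M / η * (η * ‖p - q‖) := by field_simp
        _ ≤ max K (M / η) * (‖p - q‖ * ‖p - q‖) := by
            gcongr
            exact le_max_right _ _
        _ = _ := by ring

/-! ### The gauge at a point and the Hilbert distance -/

/-- The gauge (Minkowski functional) of `U` with respect to the base point `x`: for `v ≠ 0` it is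
the inverse of the time at which the half-line `x + ℝ₊ v` leaves `U`. -/
noncomputable def gaugeAt {E : Type*} [AddCommGroup E] [Module ℝ E] (U : Set E) (x v : E) : ℝ :=
  gauge ((fun w => x + w) ⁻¹' U) v

theorem preimage_add_mem_nhds_zero {E : Type*} [NormedAddCommGroup E] {U : Set E} {x : E}
    (hU : IsOpen U) (hx : x ∈ U) :
    (fun w => x + w) ⁻¹' U ∈ 𝓝 (0 : E) :=
  (hU.preimage (continuous_const_add x)).mem_nhds (by simpa)

section gaugeAt

variable {E : Type*} [NormedAddCommGroup E] [NormedSpace ℝ E] {U : Set E} {x v w : E}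

theorem gaugeAt_nonneg : 0 ≤ gaugeAt U x v := gauge_nonneg v

@[simp]
theorem gaugeAt_zero : gaugeAt U x 0 = 0 := gauge_zero

theorem gaugeAt_smul {c : ℝ} (hc : 0 ≤ c) : gaugeAt U x (c • v) = c * gaugeAt U x v :=
  gauge_smul_of_nonneg hc v

theorem gaugeAt_add_le (hU : IsOpen U) (hconv : Convex ℝ U) (hx : x ∈ U) :
    gaugeAt U x (v + w) ≤ gaugeAt U x v + gaugeAt U x w :=
  gauge_add_le (hconv.translate_preimage_right x)
    (absorbent_nhds_zero (preimage_add_mem_nhds_zero hU hx)) v w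

theorem continuous_gaugeAt (hU : IsOpen U) (hconv : Convex ℝ U) (hx : x ∈ U) :
    Continuous (gaugeAt U x) :=
  continuous_gauge (hconv.translate_preimage_right x) (preimage_add_mem_nhds_zero hU hx)

theorem gaugeAt_lt_one_iff (hU : IsOpen U) (hconv : Convex ℝ U) (hx : x ∈ U) :
    gaugeAt U x v < 1 ↔ x + v ∈ U := by
  rw [gaugeAt, gauge_lt_one_iff_mem_interior (hconv.translate_preimage_right x)
    (preimage_add_mem_nhds_zero hU hx), (hU.preimage (continuous_const_add x)).interior_eq,
    mem_preimage]

theorem gaugeAt_lt_iff (hU : IsOpen U) (hconv : Convex ℝ U) (hx : x ∈ U) {s : ℝ} (hs : 0 < s) :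
    gaugeAt U x v < s ↔ x + s⁻¹ • v ∈ U := by
  rw [← gaugeAt_lt_one_iff hU hconv hx, gaugeAt_smul (inv_nonneg.mpr hs.le), inv_mul_lt_one₀ hs]

theorem add_mem_frontier_of_gaugeAt_eq_one (hU : IsOpen U) (hconv : Convex ℝ U) (hx : x ∈ U)
    (h : gaugeAt U x v = 1) : x + v ∈ frontier U := by
  have := (gauge_eq_one_iff_mem_frontier (hconv.translate_preimage_right x)
    (preimage_add_mem_nhds_zero hU hx)).mp h
  rw [← Homeomorph.coe_addLeft, ← Homeomorph.preimage_frontier] at this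
  exact this

theorem mul_gaugeAt_le_norm {r : ℝ} (hr : Metric.ball x r ⊆ U) : r * gaugeAt U x v ≤ ‖v‖ :=
  mul_gauge_le_norm fun w hw => hr (by simpa [dist_eq_norm] using hw)

theorem norm_le_mul_gaugeAt (hU : IsOpen U) (hx : x ∈ U) {D : ℝ} (hD : 0 < D)
    (h : ∀ y ∈ U, ‖y - x‖ ≤ D) : ‖v‖ ≤ D * gaugeAt U x v := by
  have := le_gauge_of_subset_closedBall (x := v)
    (absorbent_nhds_zero (preimage_add_mem_nhds_zero hU hx)) hD.le
    (fun w hw => by simpa using h (x + w) hw)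
  rwa [div_le_iff₀' hD] at this

theorem gaugeAt_pos (hU : IsOpen U) (hbdd : Bornology.IsBounded U) (hx : x ∈ U) (hv : v ≠ 0) :
    0 < gaugeAt U x v := by
  obtain ⟨D, hD, h⟩ := hbdd.subset_closedBall_lt 0 x
  have h1 := norm_le_mul_gaugeAt (v := v) hU hx hD
    (fun y hy => by simpa [dist_eq_norm] using h hy)
  exact pos_of_mul_pos_right ((norm_pos_iff.mpr hv).trans_le h1) hD.le

theorem abs_gaugeAt_sub_le (hU : IsOpen U) (hconv : Convex ℝ U) (hx : x ∈ U) {r : ℝ} (hr : 0 < r)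
    (hball : Metric.ball x r ⊆ U) : |gaugeAt U x v - gaugeAt U x w| ≤ ‖v - w‖ / r := by
  have h1 : ∀ u, gaugeAt U x u ≤ ‖u‖ / r := fun u => by
    rw [le_div_iff₀' hr]
    exact mul_gaugeAt_le_norm hball
  have h2 := gaugeAt_add_le (v := v - w) (w := w) hU hconv hx
  have h3 := gaugeAt_add_le (v := w - v) (w := v) hU hconv hx
  rw [sub_add_cancel] at h2 h3
  have h4 := h1 (v - w)
  have h5 := h1 (w - v)
  rw [norm_sub_rev] at h5
  rw [abs_le]
  constructor <;> linarith

end gaugeAt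

section hilbert

variable {n : ℕ} {U : Set (EuclideanSpace ℝ (Fin n))} {x y v : EuclideanSpace ℝ (Fin n)}

theorem exitPoint_eq (hU : IsOpen U) (hconv : Convex ℝ U) (hbdd : Bornology.IsBounded U)
    (hx : x ∈ U) (hv : v ≠ 0) : exitPoint U x v = x + (gaugeAt U x v)⁻¹ • v := by
  have hpos := gaugeAt_pos hU hbdd hx hv
  have : {s : ℝ | 0 ≤ s ∧ x + s • v ∈ U} = Ico 0 (gaugeAt U x v)⁻¹ := by
    ext s
    refine and_congr_right fun hs => ?_
    rw [← gaugeAt_lt_one_iff hU hconv hx, gaugeAt_smul hs, ← one_div, lt_div_iff₀ hpos]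
  rw [exitPoint, this, csSup_Ico (inv_pos.mpr hpos)]

/-- The Hilbert distance in terms of the gauge based at the first point. -/
theorem hilbertDist_eq (hU : IsOpen U) (hconv : Convex ℝ U) (hbdd : Bornology.IsBounded U)
    (hx : x ∈ U) (hy : y ∈ U) : hilbertDist U x y =
      1 / 2 * Real.log ((1 + gaugeAt U x (x - y)) / (1 - gaugeAt U x (y - x))) := by
  rw [hilbertDist]
  split_ifs with h
  · simp [h]
  have hv : y - x ≠ 0 := sub_ne_zero.mpr (Ne.symm h)
  have hv' : x - y ≠ 0 := sub_ne_zero.mpr h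
  have ha := gaugeAt_pos hU hbdd hx hv
  have hb := gaugeAt_pos hU hbdd hx hv'
  have ha1 : gaugeAt U x (y - x) < 1 := by
    rw [gaugeAt_lt_one_iff hU hconv hx]
    simpa
  rw [neg_sub, exitPoint_eq hU hconv hbdd hx hv, exitPoint_eq hU hconv hbdd hx hv']
  set a := gaugeAt U x (y - x)
  set b := gaugeAt U x (x - y)
  set u := y - x with hu
  have hxy : x - y = -u := by rw [hu, neg_sub]
  have hn : 0 < ‖u‖ := norm_pos_iff.mpr hv
  have e1 : y - (x + b⁻¹ • (x - y)) = (1 + b⁻¹) • u := by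
    rw [hxy, add_smul, one_smul, smul_neg, hu]
    abel
  have e2 : y - (x + a⁻¹ • u) = -((a⁻¹ - 1) • u) := by
    rw [sub_smul, one_smul, hu]
    abel
  have e3 : x - (x + a⁻¹ • u) = -(a⁻¹ • u) := by abel
  have e4 : x - (x + b⁻¹ • (x - y)) = b⁻¹ • u := by
    rw [hxy, smul_neg]
    abel
  have h1 : 0 < a⁻¹ - 1 := sub_pos.mpr ((one_lt_inv₀ ha).mpr ha1)
  have h2 : 0 < 1 - a := sub_pos.mpr ha1
  rw [e1, e2, e3, e4, norm_neg, norm_neg, norm_smul, norm_smul, norm_smul, norm_smul,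
    Real.norm_of_nonneg (by positivity), Real.norm_of_nonneg h1.le,
    Real.norm_of_nonneg (by positivity), Real.norm_of_nonneg (by positivity)]
  congr 2
  have h3 : a⁻¹ - 1 = (1 - a) / a := by field_simp
  rw [h3]
  field_simp
  ring

/-- In terms of the gauge `N` at the centre, the sphere of radius `t` is the level set
`N v + e⁻²ᵗ N (-v) = 1 - e⁻²ᵗ`. -/
theorem mem_hilbertSphere_iff (hU : IsOpen U) (hconv : Convex ℝ U) (hbdd : Bornology.IsBounded U)
    (hx : x ∈ U) {t : ℝ} : y ∈ hilbertSphere U x t ↔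
      gaugeAt U x (y - x) + Real.exp (-(2 * t)) * gaugeAt U x (x - y) =
        1 - Real.exp (-(2 * t)) := by
  have hε := Real.exp_pos (-(2 * t))
  have hb : 0 ≤ gaugeAt U x (x - y) := gaugeAt_nonneg
  have hmem : gaugeAt U x (y - x) < 1 ↔ y ∈ U := by
    rw [gaugeAt_lt_one_iff hU hconv hx, add_sub_cancel]
  have key : y ∈ U → (hilbertDist U x y = t ↔
      gaugeAt U x (y - x) + Real.exp (-(2 * t)) * gaugeAt U x (x - y) =
        1 - Real.exp (-(2 * t))) := fun hy => by
    have h1 : 0 < 1 - gaugeAt U x (y - x) := sub_pos.mpr (hmem.mpr hy)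
    rw [hilbertDist_eq hU hconv hbdd hx hy]
    have h2 : 0 < (1 + gaugeAt U x (x - y)) / (1 - gaugeAt U x (y - x)) := by positivity
    have h3 : ∀ r : ℝ, 0 < r → (1 / 2 * Real.log r = t ↔ r = Real.exp (2 * t)) := fun r hr =>
      ⟨fun h => by rw [← h, ← mul_assoc, mul_one_div_cancel two_ne_zero, one_mul, Real.exp_log hr],
        fun h => by rw [h, Real.log_exp]; ring⟩
    rw [h3 _ h2, div_eq_iff h1.ne', Real.exp_neg]
    have h4 := Real.exp_pos (2 * t)
    field_simp
    constructor <;> intro h <;> linarith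
  refine ⟨fun h => (key h.1).mp h.2, fun h => ?_⟩
  have hy : y ∈ U := hmem.mp (by nlinarith [mul_nonneg hε.le hb])
  exact ⟨hy, (key hy).mpr h⟩

theorem hilbertDist_le_of_gaugeAt_le (hU : IsOpen U) (hconv : Convex ℝ U)
    (hbdd : Bornology.IsBounded U) (hx : x ∈ U) {a : ℝ} (ha : a ≤ 1 / 2)
    (h1 : gaugeAt U x (y - x) ≤ a) (h2 : gaugeAt U x (x - y) ≤ a) :
    hilbertDist U x y ≤ 2 * a := by
  have hy : y ∈ U := by
    have : gaugeAt U x (y - x) < 1 := by linarith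
    rw [gaugeAt_lt_one_iff hU hconv hx] at this
    simpa using this
  have h3 : 0 < 1 - gaugeAt U x (y - x) := by linarith
  have h4 : 0 ≤ gaugeAt U x (x - y) := gaugeAt_nonneg
  have h5 : 0 ≤ gaugeAt U x (y - x) := gaugeAt_nonneg
  rw [hilbertDist_eq hU hconv hbdd hx hy]
  have h6 : Real.log ((1 + gaugeAt U x (x - y)) / (1 - gaugeAt U x (y - x))) ≤ _ :=
    Real.log_le_sub_one_of_pos (by positivity)
  have h7 : (1 + gaugeAt U x (x - y)) / (1 - gaugeAt U x (y - x)) ≤ 1 + 4 * a := by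
    rw [div_le_iff₀ h3]
    nlinarith
  linarith

theorem gaugeAt_le_of_hilbertDist_le (hU : IsOpen U) (hconv : Convex ℝ U)
    (hbdd : Bornology.IsBounded U) (hx : x ∈ U) (hy : y ∈ U) {ρ : ℝ} (hρ0 : 0 ≤ ρ)
    (hρ : ρ ≤ 1 / 2) (h : hilbertDist U x y ≤ ρ) :
    gaugeAt U x (y - x) ≤ 4 * ρ ∧ gaugeAt U x (x - y) ≤ 4 * ρ := by
  have h3 : 0 < 1 - gaugeAt U x (y - x) := by
    have : gaugeAt U x (y - x) < 1 := by
      rw [gaugeAt_lt_one_iff hU hconv hx]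
      simpa
    linarith
  have h4 : 0 ≤ gaugeAt U x (x - y) := gaugeAt_nonneg
  have h5 : 0 ≤ gaugeAt U x (y - x) := gaugeAt_nonneg
  rw [hilbertDist_eq hU hconv hbdd hx hy] at h
  have h6 : (1 + gaugeAt U x (x - y)) / (1 - gaugeAt U x (y - x)) ≤ Real.exp (2 * ρ) := by
    rw [← Real.log_le_iff_le_exp (by positivity)]
    linarith
  have h7 : Real.exp (2 * ρ) ≤ 1 + 4 * ρ := by
    have := Real.abs_exp_sub_one_le (x := 2 * ρ) (by rw [abs_of_nonneg] <;> linarith)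
    rw [abs_of_nonneg (by linarith : 0 ≤ 2 * ρ)] at this
    linarith [(abs_le.mp this).2]
  have h8 := h6.trans h7
  rw [div_le_iff₀ h3] at h8
  constructor <;> nlinarith

end hilbert

/-! ### Chords at the points of a sphere -/

/-- The level set `{o + v | N v + ε N (-v) = 1 - ε}` of the gauge `N` of `U` at `o`; for
`ε = e⁻²ᵗ` this is the sphere of radius `t` of the Hilbert geometry of `U`. -/
noncomputable def gaugeSphere {E : Type*} [AddCommGroup E] [Module ℝ E] (U : Set E) (o : E) (ε : ℝ) : Set E :=
  {x | gaugeAt U o (x - o) + ε * gaugeAt U o (o - x) = 1 - ε}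

theorem hilbertSphere_eq_gaugeSphere {n : ℕ} {U : Set (EuclideanSpace ℝ (Fin n))}
    {o : EuclideanSpace ℝ (Fin n)} (hU : IsOpen U) (hconv : Convex ℝ U)
    (hbdd : Bornology.IsBounded U) (ho : o ∈ U) (t : ℝ) :
    hilbertSphere U o t = gaugeSphere U o (Real.exp (-(2 * t))) :=
  ext fun _ => mem_hilbertSphere_iff hU hconv hbdd ho

section radialProj

variable {E : Type*} [NormedAddCommGroup E] [NormedSpace ℝ E] {U : Set E} {o x : E}

/-- The radial projection of `x` to the boundary of `U`, from `o`. -/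
noncomputable def radialProj (U : Set E) (o x : E) : E := o + (gaugeAt U o (x - o))⁻¹ • (x - o)

theorem gaugeAt_radialProj_sub (hx : 0 < gaugeAt U o (x - o)) :
    gaugeAt U o (radialProj U o x - o) = 1 := by
  rw [radialProj, add_sub_cancel_left, gaugeAt_smul (inv_nonneg.mpr hx.le), inv_mul_cancel₀ hx.ne']

theorem smul_radialProj_sub (hx : 0 < gaugeAt U o (x - o)) :
    gaugeAt U o (x - o) • (radialProj U o x - o) = x - o := by
  rw [radialProj, add_sub_cancel_left, smul_inv_smul₀ hx.ne']

theorem radialProj_sub_self (hx : 0 < gaugeAt U o (x - o)) :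
    radialProj U o x - x = (1 - gaugeAt U o (x - o)) • (radialProj U o x - o) := by
  rw [sub_smul, one_smul, smul_radialProj_sub hx]
  abel

end radialProj

theorem exists_small_constants {m C B K L : ℝ} (hm : 0 < m) (hC : 0 < C) (hK : 0 < K) (hL : 0 < L)
    (hB : 0 < B) : ∃ c ε₀ : ℝ, 0 < c ∧ c ≤ 1 ∧ C * c ≤ m ∧ 2 * K * c ^ 2 ≤ m ∧
      0 < ε₀ ∧ ε₀ < 1 ∧ ε₀ * L ≤ 1 / 2 ∧ B * ε₀ ≤ m := by
  set c := min 1 (min (m / C) (m / (2 * K))) with hc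
  have hc0 : 0 < c := by positivity
  have hc1 : c ≤ 1 := min_le_left _ _
  have hc2 : 2 * K * c ≤ m := by
    rw [← le_div_iff₀' (by positivity)]
    exact (min_le_right _ _).trans (min_le_right _ _)
  refine ⟨c, min (1 / 2) (min (1 / 2 / L) (m / B)), hc0, hc1, ?_, ?_, by positivity,
    (min_le_left _ _).trans_lt (by norm_num), ?_, ?_⟩
  · rw [← le_div_iff₀' hC]
    exact (min_le_right _ _).trans (min_le_left _ _)
  · calc 2 * K * c ^ 2 = 2 * K * c * c := by ring
      _ ≤ m * 1 := by gcongr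
      _ = m := mul_one m
  · rw [← le_div_iff₀ hL]
    exact (min_le_right _ _).trans (min_le_left _ _)
  · rw [← le_div_iff₀' hB]
    exact (min_le_right _ _).trans (min_le_right _ _)

/-- A convex domain of diameter at most `D` that contains the ball of radius `r` about `o`, and
whose boundary is pinched to second order, with constants `k` and `K`, by a functional of norm at
most `M` at each of its points. -/
structure IsPinchedDomain {E : Type*} [NormedAddCommGroup E] [NormedSpace ℝ E] (U : Set E) (o : E)
    (r D k K M : ℝ) : Prop where
  isOpen : IsOpen U
  convex : Convex ℝ U
  r_pos : 0 < r
  D_pos : 0 < D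
  k_pos : 0 < k
  K_pos : 0 < K
  M_pos : 0 < M
  ball_subset : Metric.ball o r ⊆ U
  norm_sub_le : ∀ x ∈ U, ∀ y ∈ U, ‖x - y‖ ≤ D
  support : ∀ p ∈ frontier U, ∃ l : E →L[ℝ] ℝ, ‖l‖ ≤ M ∧
    (∀ q ∈ U, k * ‖p - q‖ ^ 2 ≤ l (p - q)) ∧ ∀ q ∉ U, l (p - q) ≤ K * ‖p - q‖ ^ 2

namespace IsPinchedDomain

variable {E : Type*} [NormedAddCommGroup E] [NormedSpace ℝ E] {U : Set E} {o x y : E}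
  {r D k K M ε : ℝ}

theorem center_mem (h : IsPinchedDomain U o r D k K M) : o ∈ U :=
  h.ball_subset (Metric.mem_ball_self h.r_pos)

theorem isBounded (h : IsPinchedDomain U o r D k K M) : Bornology.IsBounded U :=
  Metric.isBounded_iff.mpr ⟨D, fun x hx y hy => by
    rw [dist_eq_norm]
    exact h.norm_sub_le x hx y hy⟩

theorem gaugeAt_le (h : IsPinchedDomain U o r D k K M) (v : E) : gaugeAt U o v ≤ ‖v‖ / r := by
  rw [le_div_iff₀' h.r_pos]
  exact mul_gaugeAt_le_norm h.ball_subset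

theorem norm_le (h : IsPinchedDomain U o r D k K M) (v : E) : ‖v‖ ≤ D * gaugeAt U o v :=
  norm_le_mul_gaugeAt h.isOpen h.center_mem h.D_pos
    fun y hy => h.norm_sub_le y hy o h.center_mem

theorem abs_gaugeAt_sub_le (h : IsPinchedDomain U o r D k K M) (v w : E) :
    |gaugeAt U o v - gaugeAt U o w| ≤ ‖v - w‖ / r :=
  _root_.abs_gaugeAt_sub_le h.isOpen h.convex h.center_mem h.r_pos h.ball_subset

theorem mem_of_mem_gaugeSphere (h : IsPinchedDomain U o r D k K M) (hε : 0 < ε)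
    (hx : x ∈ gaugeSphere U o ε) : x ∈ U := by
  have h1 : 0 ≤ gaugeAt U o (o - x) := gaugeAt_nonneg
  have h2 : gaugeAt U o (x - o) + ε * gaugeAt U o (o - x) = 1 - ε := hx
  have h3 : gaugeAt U o (x - o) < 1 := by nlinarith
  rw [gaugeAt_lt_one_iff h.isOpen h.convex h.center_mem] at h3
  simpa using h3

/-- The gauge on the level set of parameter `ε` is `1 - O(ε)`, and not closer to `1` than `ε`. -/
theorem one_sub_gaugeAt_bounds (h : IsPinchedDomain U o r D k K M) (hε : 0 < ε)
    (hx : x ∈ gaugeSphere U o ε) : ε ≤ 1 - gaugeAt U o (x - o) ∧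
      1 - gaugeAt U o (x - o) ≤ ε * (1 + D / r) := by
  have h1 : 0 ≤ gaugeAt U o (o - x) := gaugeAt_nonneg
  have h2 : gaugeAt U o (x - o) + ε * gaugeAt U o (o - x) = 1 - ε := hx
  have h3 : gaugeAt U o (o - x) ≤ D / r := (h.gaugeAt_le _).trans (by
    have := h.norm_sub_le o h.center_mem x (h.mem_of_mem_gaugeSphere hε hx)
    have := h.r_pos
    gcongr)
  constructor <;> nlinarith

theorem gaugeAt_pos_of_mem_gaugeSphere (h : IsPinchedDomain U o r D k K M) (hε1 : ε < 1)
    (hx : x ∈ gaugeSphere U o ε) : 0 < gaugeAt U o (x - o) := by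
  refine gaugeAt_pos h.isOpen h.isBounded h.center_mem fun h0 => ?_
  have h2 : gaugeAt U o (x - o) + ε * gaugeAt U o (o - x) = 1 - ε := hx
  rw [← neg_sub x o, h0] at h2
  simp at h2
  linarith

theorem radialProj_mem_frontier (h : IsPinchedDomain U o r D k K M)
    (hx : 0 < gaugeAt U o (x - o)) : radialProj U o x ∈ frontier U := by
  have := gaugeAt_radialProj_sub hx
  rw [radialProj, add_sub_cancel_left] at this
  exact add_mem_frontier_of_gaugeAt_eq_one h.isOpen h.convex h.center_mem this

theorem norm_radialProj_sub_le (h : IsPinchedDomain U o r D k K M)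
    (hx : 0 < gaugeAt U o (x - o)) : ‖radialProj U o x - o‖ ≤ D := by
  simpa [gaugeAt_radialProj_sub hx] using h.norm_le (radialProj U o x - o)

theorem le_norm_radialProj_sub (h : IsPinchedDomain U o r D k K M)
    (hx : 0 < gaugeAt U o (x - o)) : r ≤ ‖radialProj U o x - o‖ := by
  have := h.gaugeAt_le (radialProj U o x - o)
  rwa [gaugeAt_radialProj_sub hx, le_div_iff₀ h.r_pos, one_mul] at this

theorem norm_radialProj_sub_self_le (h : IsPinchedDomain U o r D k K M) (hε : 0 < ε) (hε1 : ε < 1)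
    (hx : x ∈ gaugeSphere U o ε) : ‖radialProj U o x - x‖ ≤ ε * (1 + D / r) * D := by
  have h0 := h.gaugeAt_pos_of_mem_gaugeSphere hε1 hx
  obtain ⟨h1, h2⟩ := h.one_sub_gaugeAt_bounds hε hx
  rw [radialProj_sub_self h0, norm_smul, Real.norm_of_nonneg (hε.le.trans h1)]
  exact mul_le_mul h2 (h.norm_radialProj_sub_le h0) (norm_nonneg _) (by linarith)

/-- A chord of `U` with midpoint at depth `O(ε)` has length `O(√ε)`: this is where the boundary
curvature is bounded below. -/
theorem mul_norm_sq_le_of_add_mem_of_sub_mem (h : IsPinchedDomain U o r D k K M) (hε : 0 < ε)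
    (hε1 : ε < 1) (hx : x ∈ gaugeSphere U o ε) {w : E} (h1 : x + w ∈ U) (h2 : x - w ∈ U) :
    k * ‖w‖ ^ 2 ≤ M * (1 + D / r) * D * ε := by
  have h0 := h.gaugeAt_pos_of_mem_gaugeSphere hε1 hx
  obtain ⟨l, hl, hlow, -⟩ := h.support _ (h.radialProj_mem_frontier h0)
  have h3 := h.norm_radialProj_sub_self_le hε hε1 hx
  set p := radialProj U o x
  have h4 := hlow _ h1
  have h5 := hlow _ h2
  have h6 : l (p - (x + w)) + l (p - (x - w)) = 2 * l (p - x) := by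
    simp only [map_sub, map_add]
    ring
  have h7 : l (p - x) ≤ M * ‖p - x‖ := (Real.le_norm_self _).trans (l.le_of_opNorm_le hl _)
  have h8 : 2 * ‖w‖ ≤ ‖p - (x + w)‖ + ‖p - (x - w)‖ := by
    have : (2 : ℝ) • w = (p - (x - w)) - (p - (x + w)) := by
      rw [two_smul]
      abel
    have h9 := _root_.norm_sub_le (p - (x - w)) (p - (x + w))
    rw [← this, norm_smul] at h9
    norm_num at h9
    linarith
  have h9 : 2 * ‖w‖ ^ 2 ≤ ‖p - (x + w)‖ ^ 2 + ‖p - (x - w)‖ ^ 2 := by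
    nlinarith [sq_nonneg (‖p - (x + w)‖ - ‖p - (x - w)‖), norm_nonneg w]
  have h10 := mul_le_mul_of_nonneg_left h9 h.k_pos.le
  have h11 := mul_le_mul_of_nonneg_left h3 h.M_pos.le
  linarith

/-- A support functional of `U` at the boundary point `p` is dominated by a multiple of the
gauge. -/
theorem support_le_mul_gaugeAt (h : IsPinchedDomain U o r D k K M) {l : E →L[ℝ] ℝ} {p : E}
    (hlow : ∀ q ∈ U, k * ‖p - q‖ ^ 2 ≤ l (p - q)) (v : E) :
    l v ≤ l (p - o) * gaugeAt U o v := by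
  have h0 : 0 ≤ l (p - o) :=
    (mul_nonneg h.k_pos.le (sq_nonneg _)).trans (hlow o h.center_mem)
  have key : ∀ s, gaugeAt U o v < s → l v ≤ l (p - o) * s := fun s hs => by
    have hs0 : 0 < s := gaugeAt_nonneg.trans_lt hs
    have h1 := hlow _ ((gaugeAt_lt_iff h.isOpen h.convex h.center_mem hs0).mp hs)
    have h2 : p - (o + s⁻¹ • v) = (p - o) - s⁻¹ • v := by abel
    have h3 := (mul_nonneg h.k_pos.le (sq_nonneg _)).trans h1
    rw [h2, map_sub, map_smul, smul_eq_mul, sub_nonneg, inv_mul_le_iff₀ hs0] at h3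
    linarith
  have hlim : Tendsto (fun s => l (p - o) * s) (𝓝[>] gaugeAt U o v)
      (𝓝 (l (p - o) * gaugeAt U o v)) :=
    (tendsto_id.mono_left nhdsWithin_le_nhds).const_mul _
  exact ge_of_tendsto hlim (eventually_nhdsWithin_of_forall key)

theorem norm_radialProj_sub_radialProj_le (h : IsPinchedDomain U o r D k K M)
    (hx : 1 / 2 ≤ gaugeAt U o (x - o)) (hy : 1 / 2 ≤ gaugeAt U o (y - o)) :
    ‖radialProj U o x - radialProj U o y‖ ≤ 2 * (1 + D / r) * ‖y - x‖ := by
  have hx0 : 0 < gaugeAt U o (x - o) := by linarith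
  have hy0 : 0 < gaugeAt U o (y - o) := by linarith
  have h1 := smul_radialProj_sub hx0
  have h2 := smul_radialProj_sub hy0
  have h3 := h.norm_radialProj_sub_le hy0
  have hr := h.r_pos
  have h4 := h.abs_gaugeAt_sub_le (y - o) (x - o)
  rw [sub_sub_sub_cancel_right] at h4
  set a := gaugeAt U o (x - o)
  set b := gaugeAt U o (y - o)
  set p := radialProj U o x
  set q := radialProj U o y
  have h5 : a • (p - q) = (b - a) • (q - o) - (y - x) := by
    have : p - q = (p - o) - (q - o) := by abel
    rw [this, smul_sub, h1, sub_smul, h2]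
    abel
  have h6 : a * ‖p - q‖ ≤ ‖y - x‖ / r * D + ‖y - x‖ := by
    calc a * ‖p - q‖ = ‖a • (p - q)‖ := by rw [norm_smul, Real.norm_of_nonneg hx0.le]
      _ ≤ ‖(b - a) • (q - o)‖ + ‖y - x‖ := by rw [h5]; exact _root_.norm_sub_le _ _
      _ = |b - a| * ‖q - o‖ + ‖y - x‖ := by rw [norm_smul, Real.norm_eq_abs]
      _ ≤ _ := by gcongr
  have h7 : 1 / 2 * ‖p - q‖ ≤ a * ‖p - q‖ := by gcongr
  have h8 : 2 * (1 + D / r) * ‖y - x‖ = 2 * (‖y - x‖ / r * D + ‖y - x‖) := by ring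
  linarith

/-- The level sets are almost tangent to the boundary: the support functional at the radial
projection of `x` is of order `ε ‖y - x‖ + ‖y - x‖ ^ 2` on `y - x`. -/
theorem abs_support_sub_le (h : IsPinchedDomain U o r D k K M) (hε : 0 < ε)
    (hε1 : ε * (1 + D / r) ≤ 1 / 2) (hx : x ∈ gaugeSphere U o ε) (hy : y ∈ gaugeSphere U o ε)
    {l : E →L[ℝ] ℝ} (hl : ‖l‖ ≤ M)
    (hlow : ∀ q ∈ U, k * ‖radialProj U o x - q‖ ^ 2 ≤ l (radialProj U o x - q))
    (hupp : ∀ q ∉ U, l (radialProj U o x - q) ≤ K * ‖radialProj U o x - q‖ ^ 2) :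
    |l (y - x)| ≤ M * D / r * (ε * ‖y - x‖) + 4 * K * (1 + D / r) ^ 2 * ‖y - x‖ ^ 2 := by
  have hx2 : 1 / 2 ≤ gaugeAt U o (x - o) := by linarith [(h.one_sub_gaugeAt_bounds hε hx).2]
  have hy2 : 1 / 2 ≤ gaugeAt U o (y - o) := by linarith [(h.one_sub_gaugeAt_bounds hε hy).2]
  have hy1 : gaugeAt U o (y - o) ≤ 1 := by linarith [(h.one_sub_gaugeAt_bounds hε hy).1]
  have hx0 : 0 < gaugeAt U o (x - o) := by linarith
  have hy0 : 0 < gaugeAt U o (y - o) := by linarith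
  have hr := h.r_pos
  have hK := h.K_pos
  have hM := h.M_pos
  have hD := h.D_pos
  have h1 : l (x - o) = l (radialProj U o x - o) * gaugeAt U o (x - o) := by
    conv_lhs => rw [← smul_radialProj_sub hx0]
    rw [map_smul, smul_eq_mul, mul_comm]
  have h2 := h.support_le_mul_gaugeAt hlow (y - o)
  have hq : radialProj U o y ∉ U := by
    have := h.radialProj_mem_frontier hy0
    rw [h.isOpen.frontier_eq] at this
    exact this.2
  have h3 := hupp _ hq
  have h4 := h.norm_radialProj_sub_radialProj_le hx2 hy2
  have h5 : l (y - o) = l (radialProj U o y - o) * gaugeAt U o (y - o) := by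
    conv_lhs => rw [← smul_radialProj_sub hy0]
    rw [map_smul, smul_eq_mul, mul_comm]
  have h6 : l (radialProj U o x - radialProj U o y) =
      l (radialProj U o x - o) - l (radialProj U o y - o) := by
    rw [← map_sub, sub_sub_sub_cancel_right]
  have hH0 : 0 ≤ l (radialProj U o x - o) :=
    (mul_nonneg h.k_pos.le (sq_nonneg _)).trans (hlow o h.center_mem)
  have hH : l (radialProj U o x - o) ≤ M * D :=
    ((Real.le_norm_self _).trans (l.le_of_opNorm_le hl _)).trans
      (mul_le_mul_of_nonneg_left (h.norm_radialProj_sub_le hx0) hM.le)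
  set H := l (radialProj U o x - o)
  -- On the level set the variation of the gauge is `ε` times the variation of the opposite gauge.
  have hgap : |gaugeAt U o (y - o) - gaugeAt U o (x - o)| ≤ ε * (‖y - x‖ / r) := by
    have e1 : gaugeAt U o (x - o) + ε * gaugeAt U o (o - x) = 1 - ε := hx
    have e2 : gaugeAt U o (y - o) + ε * gaugeAt U o (o - y) = 1 - ε := hy
    have e3 := h.abs_gaugeAt_sub_le (o - x) (o - y)
    rw [sub_sub_sub_cancel_left] at e3
    have e4 : gaugeAt U o (y - o) - gaugeAt U o (x - o) =
        ε * (gaugeAt U o (o - x) - gaugeAt U o (o - y)) := by linarith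
    rw [e4, abs_mul, abs_of_pos hε]
    gcongr
  have hHgap : |H * (gaugeAt U o (y - o) - gaugeAt U o (x - o))| ≤
      M * D / r * (ε * ‖y - x‖) := by
    rw [abs_mul, abs_of_nonneg hH0]
    calc _ ≤ M * D * (ε * (‖y - x‖ / r)) := by gcongr
      _ = _ := by ring
  have hlyx : l (y - x) = l (y - o) - l (x - o) := by rw [← map_sub, sub_sub_sub_cancel_right]
  have h7 : K * ‖radialProj U o x - radialProj U o y‖ ^ 2 ≤
      4 * K * (1 + D / r) ^ 2 * ‖y - x‖ ^ 2 := by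
    calc _ ≤ K * (2 * (1 + D / r) * ‖y - x‖) ^ 2 := by gcongr
      _ = _ := by ring
  have h8 : 0 ≤ 4 * K * (1 + D / r) ^ 2 * ‖y - x‖ ^ 2 := by positivity
  have h9 : (H - l (radialProj U o y - o)) * gaugeAt U o (y - o) ≤
      4 * K * (1 + D / r) ^ 2 * ‖y - x‖ ^ 2 := by
    rw [h6] at h3
    have := mul_le_mul_of_nonneg_right (h3.trans h7) hy0.le
    nlinarith
  rw [abs_le] at hHgap ⊢
  rw [hlyx, h1]
  constructor
  · rw [h5]
    linarith [hHgap.1]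
  · linarith [hHgap.2]

set_option maxHeartbeats 400000 in
/-- Around a point of the level set of parameter `ε`, in directions joining it to a nearby point of
the same level set, `U` contains chords of length of order `√ε`: this is where the boundary
curvature is bounded above. -/
theorem exists_add_smul_mem (h : IsPinchedDomain U o r D k K M) :
    ∃ c ε₀ : ℝ, 0 < c ∧ 0 < ε₀ ∧ ε₀ < 1 ∧ ∀ ε, 0 < ε → ε ≤ ε₀ → ∀ x ∈ gaugeSphere U o ε,
      ∀ y ∈ gaugeSphere U o ε, ‖y - x‖ ≤ c * √ε → ∀ τ : ℝ, |τ| * ‖y - x‖ ≤ c * √ε →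
        x + τ • (y - x) ∈ U := by
  have hr := h.r_pos
  have hK := h.K_pos
  have hM := h.M_pos
  have hD := h.D_pos
  have hk := h.k_pos
  set L := 1 + D / r with hL
  have hL1 : 1 ≤ L := by
    have : 0 < D / r := by positivity
    linarith
  have hL0 : 0 < L := by linarith
  set C := M * D / r + 4 * K * L ^ 2 with hC
  have hC0 : 0 < C := by positivity
  set m := k * r ^ 2 with hm
  have hm0 : 0 < m := by positivity
  obtain ⟨c, ε₀, hc0, hc1, hc2, hc3, hε0, hε1, hε2, hε3⟩ :=
    exists_small_constants (m := m / 4) (B := 2 * K * (L * D) ^ 2) (by positivity) hC0 hK hL0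
      (by positivity)
  refine ⟨c, ε₀, hc0, hε0, hε1, fun ε hε hεle x hx y hy hxy τ hτ => ?_⟩
  have hεL : ε * L ≤ 1 / 2 := (mul_le_mul_of_nonneg_right hεle hL0.le).trans hε2
  have hε1' : ε < 1 := hεle.trans_lt hε1
  have h0 := h.gaugeAt_pos_of_mem_gaugeSphere hε1' hx
  obtain ⟨l, hl, hlow, hupp⟩ := h.support _ (h.radialProj_mem_frontier h0)
  have h1 := h.abs_support_sub_le hε hεL hx hy hl hlow hupp
  have h2 := h.norm_radialProj_sub_self_le hε hε1' hx
  have h3 := h.le_norm_radialProj_sub h0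
  have h4 := hlow o h.center_mem
  have h5 : l (radialProj U o x - x) =
      (1 - gaugeAt U o (x - o)) * l (radialProj U o x - o) := by
    rw [radialProj_sub_self h0, map_smul, smul_eq_mul]
  have h6 := (h.one_sub_gaugeAt_bounds hε hx).1
  set p := radialProj U o x
  by_contra hz
  have h7 := hupp _ hz
  have hsq : √ε * √ε = ε := Real.mul_self_sqrt hε.le
  have hs0 : 0 < √ε := Real.sqrt_pos.mpr hε
  have hs1 : ε ≤ √ε := by
    have : √ε ≤ 1 := Real.sqrt_le_one.mpr hε1'.le
    nlinarith
  -- The support functional is at least `m ε` at `x`.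
  have h8 : m * ε ≤ l (p - x) := by
    rw [h5]
    have e1 : k * r ^ 2 ≤ k * ‖p - o‖ ^ 2 := by gcongr
    have e2 : m ≤ l (p - o) := e1.trans h4
    have e3 : 0 ≤ l (p - o) := hm0.le.trans e2
    calc m * ε ≤ l (p - o) * (1 - gaugeAt U o (x - o)) := by gcongr
      _ = _ := mul_comm _ _
  have h9 : |l (y - x)| ≤ C * (√ε * ‖y - x‖) := by
    have e1 : ε * ‖y - x‖ ≤ √ε * ‖y - x‖ := by gcongr
    have e2 : ‖y - x‖ ^ 2 ≤ √ε * ‖y - x‖ := by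
      rw [pow_two]
      exact mul_le_mul_of_nonneg_right (hxy.trans (mul_le_of_le_one_left hs0.le hc1))
        (norm_nonneg _)
    calc _ ≤ _ := h1
      _ ≤ M * D / r * (√ε * ‖y - x‖) + 4 * K * L ^ 2 * (√ε * ‖y - x‖) := by gcongr
      _ = _ := by ring
  have h10 : |τ * l (y - x)| ≤ m / 4 * ε := by
    rw [abs_mul]
    calc |τ| * |l (y - x)| ≤ |τ| * (C * (√ε * ‖y - x‖)) := by gcongr
      _ = C * √ε * (|τ| * ‖y - x‖) := by ring
      _ ≤ C * √ε * (c * √ε) := by gcongr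
      _ = C * c * (√ε * √ε) := by ring
      _ = C * c * ε := by rw [hsq]
      _ ≤ _ := by gcongr
  have h11 : p - (x + τ • (y - x)) = (p - x) - τ • (y - x) := by abel
  have h12 : ‖p - (x + τ • (y - x))‖ ^ 2 ≤ 2 * (ε * L * D) ^ 2 + 2 * (c * √ε) ^ 2 := by
    have e1 : ‖p - (x + τ • (y - x))‖ ≤ ε * L * D + c * √ε := by
      rw [h11]
      refine (_root_.norm_sub_le _ _).trans (add_le_add h2 ?_)
      rwa [norm_smul, Real.norm_eq_abs]
    calc _ ≤ (ε * L * D + c * √ε) ^ 2 := by gcongr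
      _ ≤ _ := by nlinarith [sq_nonneg (ε * L * D - c * √ε)]
  have h13 : K * ‖p - (x + τ • (y - x))‖ ^ 2 ≤ m / 2 * ε := by
    calc _ ≤ K * (2 * (ε * L * D) ^ 2 + 2 * (c * √ε) ^ 2) := by gcongr
      _ = 2 * K * (L * D) ^ 2 * ε * ε + 2 * K * c ^ 2 * (√ε * √ε) := by ring
      _ ≤ 2 * K * (L * D) ^ 2 * ε₀ * ε + m / 4 * ε := by rw [hsq]; gcongr
      _ ≤ m / 4 * ε + m / 4 * ε := by gcongr
      _ = _ := by ring
  rw [h11, map_sub, map_smul, smul_eq_mul, ← h11] at h7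
  have h14 := (abs_le.mp h10).2
  have h15 : 0 < m * ε := by positivity
  linarith

end IsPinchedDomain

/-! ### Bounds of the Hausdorff measure by nets and by projections -/

section hausdorff

variable {X : Type*} {d : X → X → ℝ} {n : ℕ} {A : Set X}

/-- A set with an `(a / m)`-net of at most `B mⁿ` points for every large `m` has finite
`n`-dimensional measure. -/
theorem hausdorffVol_le_of_nets {a : ℝ} (ha : 0 < a) {B : ℕ}
    (h : ∀ᶠ m : ℕ in atTop, ∃ s : Finset X, s.card ≤ B * m ^ n ∧ (∀ z ∈ s, z ∈ A) ∧
      ∀ p ∈ A, ∃ z ∈ s, d z p ≤ a / m) :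
    hausdorffVol d n A ≤
      volume (Metric.ball (0 : EuclideanSpace ℝ (Fin n)) 1) * (B * ENNReal.ofReal a ^ n) := by
  classical
  refine iSup₂_le fun r hr => ?_
  have hlim : Tendsto (fun m : ℕ => 2 * (a / (m : ℝ))) atTop (𝓝 0) := by
    simpa using (tendsto_const_div_atTop_nhds_zero_nat a).const_mul 2
  obtain ⟨m, ⟨s, hcard, hsA, hcov⟩, hm, hm0⟩ :=
    (h.and ((hlim.eventually (gt_mem_nhds hr)).and (eventually_gt_atTop 0))).exists
  have hm0' : (0 : ℝ) < m := by exact_mod_cast hm0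
  refine mul_le_mul_right ?_ _
  set c : Finset (X × ℝ) := s.image fun z => (z, a / m) with hc
  have hcmem : ∀ b ∈ c, b.1 ∈ s ∧ b.2 = a / m := fun b hb => by
    obtain ⟨z, hz, rfl⟩ := Finset.mem_image.mp hb
    exact ⟨hz, rfl⟩
  refine iInf_le_of_le (c : Set (X × ℝ)) (iInf_le_of_le c.countable_toSet (iInf_le_of_le ?_
    (iInf_le_of_le ?_ ?_)))
  · intro b hb
    obtain ⟨h1, h2⟩ := hcmem b hb
    exact ⟨hsA _ h1, by rw [h2]; positivity, by rw [h2]; exact hm⟩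
  · intro p hp
    obtain ⟨z, hz, hzp⟩ := hcov p hp
    exact ⟨(z, a / m), Finset.mem_image_of_mem _ hz, hzp⟩
  · calc ∑' b : (c : Set (X × ℝ)), ENNReal.ofReal b.1.2 ^ n
        = ∑ b ∈ c, ENNReal.ofReal b.2 ^ n :=
          c.tsum_subtype fun b : X × ℝ => ENNReal.ofReal b.2 ^ n
      _ = ∑ b ∈ c, ENNReal.ofReal (a / m) ^ n :=
          Finset.sum_congr rfl fun b hb => by rw [(hcmem b hb).2]
      _ = c.card * ENNReal.ofReal (a / m) ^ n := by rw [Finset.sum_const, nsmul_eq_mul]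
      _ ≤ ((B * m ^ n : ℕ) : ℝ≥0∞) * ENNReal.ofReal (a / m) ^ n := by
          gcongr
          exact Finset.card_image_le.trans hcard
      _ = B * ENNReal.ofReal a ^ n := by
          rw [Nat.cast_mul, Nat.cast_pow, mul_assoc, ← mul_pow, ← ENNReal.ofReal_natCast m,
            ← ENNReal.ofReal_mul hm0'.le, mul_div_cancel₀ _ hm0'.ne']

/-- A map to `ℝⁿ` that is Lipschitz at small scales bounds the `n`-dimensional measure below by the
Lebesgue measure of the image. -/
theorem volume_image_le_mul_hausdorffVol {f : X → EuclideanSpace ℝ (Fin n)} {L r : ℝ} (hL : 0 < L)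
    (hr : 0 < r) (h : ∀ x ∈ A, ∀ ρ, 0 < ρ → 2 * ρ < r → ∀ y ∈ A, d x y ≤ ρ →
      ‖f y - f x‖ ≤ L * ρ) :
    volume (f '' A) ≤ ENNReal.ofReal L ^ n * hausdorffVol d n A := by
  have hcont : hausdorffContent d n r A ≤ hausdorffVol d n A :=
    le_iSup₂ (f := fun (r : ℝ) (_ : 0 < r) => hausdorffContent d n r A) r hr
  refine le_trans ?_ (mul_le_mul_right hcont _)
  rw [hausdorffContent, ← mul_assoc]
  set v := volume (Metric.ball (0 : EuclideanSpace ℝ (Fin n)) 1) with hv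
  have hv0 : v ≠ 0 := (Metric.measure_ball_pos volume _ one_pos).ne'
  have hv1 : v ≠ ∞ := measure_ball_lt_top.ne
  have hκ0 : ENNReal.ofReal L ^ n * v ≠ 0 :=
    mul_ne_zero (pow_ne_zero _ (ENNReal.ofReal_pos.mpr hL).ne') hv0
  have hκ1 : ENNReal.ofReal L ^ n * v ≠ ∞ :=
    ENNReal.mul_ne_top (ENNReal.pow_ne_top ENNReal.ofReal_ne_top) hv1
  rw [mul_comm, ← ENNReal.div_le_iff hκ0 hκ1]
  refine le_iInf fun c => le_iInf fun hc => le_iInf fun hball => le_iInf fun hcov => ?_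
  rw [ENNReal.div_le_iff hκ0 hκ1]
  have : Countable c := hc.to_subtype
  have hsub : f '' A ⊆ ⋃ b : c, Metric.closedBall (f b.1.1) (L * b.1.2) := by
    rintro _ ⟨p, hp, rfl⟩
    obtain ⟨b, hb, hbp⟩ := hcov p hp
    obtain ⟨h1, h2, h3⟩ := hball b hb
    refine mem_iUnion.mpr ⟨⟨b, hb⟩, ?_⟩
    rw [Metric.mem_closedBall, dist_eq_norm]
    exact h _ h1 _ h2 h3 p hp hbp
  calc volume (f '' A) ≤ ∑' b : c, volume (Metric.closedBall (f b.1.1) (L * b.1.2)) :=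
        (measure_mono hsub).trans (measure_iUnion_le _)
    _ = ∑' b : c, ENNReal.ofReal b.1.2 ^ n * (ENNReal.ofReal L ^ n * v) := by
        congr 1 with b
        rw [Measure.addHaar_closedBall _ _ (mul_pos hL (hball b b.2).2.1).le,
          finrank_euclideanSpace_fin, ENNReal.ofReal_pow (mul_pos hL (hball b b.2).2.1).le,
          ENNReal.ofReal_mul hL.le, mul_pow]
        ring
    _ = _ := ENNReal.tsum_mul_right

end hausdorff

/-! ### Nets of the boundary of a cube -/

section cube

theorem exists_fin_abs_sub_le {m : ℕ} (hm : 0 < m) {u : ℝ} (hu : |u| ≤ 1) :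
    ∃ g : Fin m, |u - (-1 + (2 * (g : ℝ) + 1) / m)| ≤ 1 / m := by
  have hm' : (0 : ℝ) < m := by exact_mod_cast hm
  obtain ⟨h1, h2⟩ := abs_le.mp hu
  have key : ∀ g : ℝ, g ≤ (u + 1) * m / 2 → (u + 1) * m / 2 ≤ g + 1 →
      |u - (-1 + (2 * g + 1) / m)| ≤ 1 / m := fun g hg1 hg2 => by
    have e : u - (-1 + (2 * g + 1) / m) = ((u + 1) * m - (2 * g + 1)) / m := by
      field_simp
      ring
    rw [e, abs_div, abs_of_pos hm']
    gcongr
    rw [abs_le]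
    constructor <;> linarith
  have hnn : 0 ≤ (u + 1) * m / 2 := by
    have : 0 ≤ u + 1 := by linarith
    positivity
  -- The floor equals `m`, one too many, when `u = 1`.
  rcases lt_or_ge ⌊(u + 1) * m / 2⌋₊ m with hlt | hge
  · exact ⟨⟨_, hlt⟩, key _ (Nat.floor_le hnn) (Nat.lt_floor_add_one _).le⟩
  · have hge' : (m : ℝ) ≤ (u + 1) * m / 2 :=
      (Nat.cast_le.mpr hge).trans (Nat.floor_le hnn)
    have hle : (u + 1) * m / 2 ≤ m := by nlinarith
    refine ⟨⟨m - 1, Nat.sub_lt hm one_pos⟩, ?_⟩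
    have hcast : ((m - 1 : ℕ) : ℝ) = m - 1 := by rw [Nat.cast_sub hm, Nat.cast_one]
    simp only [hcast]
    exact key _ (by linarith) (by linarith)

theorem EuclideanSpace.norm_le_card_mul {n : ℕ} {w : EuclideanSpace ℝ (Fin n)} {b : ℝ}
    (hb : 0 ≤ b) (h : ∀ j, |w j| ≤ b) : ‖w‖ ≤ n * b := by
  rw [EuclideanSpace.norm_eq, Real.sqrt_le_left (by positivity)]
  calc ∑ j, ‖w j‖ ^ 2 ≤ ∑ _j : Fin n, b ^ 2 :=
        Finset.sum_le_sum fun j _ => pow_le_pow_left₀ (norm_nonneg _) (h j) 2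
    _ = n * b ^ 2 := by simp
    _ ≤ n * n * b ^ 2 := by
        gcongr
        exact_mod_cast Nat.le_mul_self n
    _ = _ := by ring

/-- The boundary of the cube `[-1, 1]ⁿ⁺¹` has `(n + 1) / m`-nets of at most `2 (n + 1) mⁿ`
points. -/
theorem exists_net_cube_boundary (n : ℕ) {m : ℕ} (hm : 0 < m) :
    ∃ s : Finset (EuclideanSpace ℝ (Fin (n + 1))), s.card ≤ 2 * (n + 1) * m ^ n ∧
      (∀ z ∈ s, 1 ≤ ‖z‖) ∧ ∀ w : EuclideanSpace ℝ (Fin (n + 1)), (∀ j, |w j| ≤ 1) →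
        (∃ i, |w i| = 1) → ∃ z ∈ s, ‖w - z‖ ≤ (n + 1) / m := by
  classical
  let f : Bool × Fin (n + 1) × (Fin n → Fin m) → EuclideanSpace ℝ (Fin (n + 1)) := fun q =>
    WithLp.toLp 2 (q.2.1.insertNth (α := fun _ => ℝ) (if q.1 then 1 else -1)
      fun j => -1 + (2 * (q.2.2 j : ℝ) + 1) / m)
  refine ⟨Finset.univ.image f, ?_, ?_, ?_⟩
  · refine Finset.card_image_le.trans (le_of_eq ?_)
    simp
    ring
  · simp only [Finset.mem_image, Finset.mem_univ, true_and, forall_exists_index,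
      forall_apply_eq_imp_iff]
    intro q
    have h1 : |f q q.2.1| = 1 := by
      simp only [f, Fin.insertNth_apply_same]
      split_ifs <;> simp
    have h2 := PiLp.norm_apply_le (f q) q.2.1
    rwa [Real.norm_eq_abs, h1] at h2
  · intro w hw hi
    obtain ⟨i, hi⟩ := hi
    choose g hg using fun j => exists_fin_abs_sub_le hm (hw (i.succAbove j))
    have hm' : (0 : ℝ) < m := by exact_mod_cast hm
    obtain ⟨b, hb⟩ : ∃ b : Bool, w i = if b then 1 else -1 := by
      rcases eq_or_eq_neg_of_abs_eq hi with h | h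
      · exact ⟨true, by simpa using h⟩
      · exact ⟨false, by simpa using h⟩
    refine ⟨f (b, i, g), Finset.mem_image_of_mem _ (Finset.mem_univ _), ?_⟩
    have := EuclideanSpace.norm_le_card_mul (w := w - f (b, i, g)) (b := 1 / m) (by positivity)
      (fun j => by
        rw [PiLp.sub_apply]
        rcases Fin.eq_self_or_eq_succAbove i j with rfl | ⟨j, rfl⟩
        · simp only [f, Fin.insertNth_apply_same, ← hb, sub_self, abs_zero]
          positivity
        · simpa only [f, Fin.insertNth_apply_succAbove] using hg j)
    refine this.trans (le_of_eq ?_)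
    push_cast
    ring

end cube

/-! ### The projection to the last `n` coordinates -/

/-- The orthogonal projection `ℝⁿ⁺¹ → ℝⁿ` that forgets the first coordinate. -/
def tailProj {n : ℕ} (x : EuclideanSpace ℝ (Fin (n + 1))) : EuclideanSpace ℝ (Fin n) :=
  WithLp.toLp 2 fun i => x i.succ

theorem norm_sq_eq_add_norm_tailProj_sq {n : ℕ} (x : EuclideanSpace ℝ (Fin (n + 1))) :
    ‖x‖ ^ 2 = x 0 ^ 2 + ‖tailProj x‖ ^ 2 := by
  simp [EuclideanSpace.norm_sq_eq, tailProj, Fin.sum_univ_succ]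

theorem norm_tailProj_sub_le {n : ℕ} (x y : EuclideanSpace ℝ (Fin (n + 1))) :
    ‖tailProj x - tailProj y‖ ≤ ‖x - y‖ := by
  have h1 := norm_sq_eq_add_norm_tailProj_sq (x - y)
  have h2 : tailProj (x - y) = tailProj x - tailProj y := rfl
  rw [← h2]
  refine (sq_le_sq₀ (norm_nonneg _) (norm_nonneg _)).mp ?_
  linarith [sq_nonneg ((x - y) 0)]

/-! ### Nets of the level sets and the upper bound -/

/-- The point of the level set of parameter `ε` on the half-line `o + ℝ₊ w`. -/
noncomputable def sphereProj {E : Type*} [AddCommGroup E] [Module ℝ E] (U : Set E) (o : E) (ε : ℝ) (w : E) : E :=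
  o + ((1 - ε) / (gaugeAt U o w + ε * gaugeAt U o (-w))) • w

namespace IsPinchedDomain

section norm

variable {E : Type*} [NormedAddCommGroup E] [NormedSpace ℝ E] {U : Set E} {o : E}
  {r D k K M ε : ℝ}

theorem norm_le_mul_gauge_add (h : IsPinchedDomain U o r D k K M) (hε : 0 ≤ ε) (v : E) :
    ‖v‖ ≤ D * (gaugeAt U o v + ε * gaugeAt U o (-v)) :=
  (h.norm_le v).trans (mul_le_mul_of_nonneg_left
    (le_add_of_nonneg_right (mul_nonneg hε gaugeAt_nonneg)) h.D_pos.le)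

theorem gauge_add_pos (h : IsPinchedDomain U o r D k K M) (hε : 0 ≤ ε) {v : E} (hv : v ≠ 0) :
    0 < gaugeAt U o v + ε * gaugeAt U o (-v) :=
  pos_of_mul_pos_right ((norm_pos_iff.mpr hv).trans_le (h.norm_le_mul_gauge_add hε v)) h.D_pos.le

theorem abs_gauge_add_sub_le (h : IsPinchedDomain U o r D k K M) (hε : 0 ≤ ε) (hε1 : ε ≤ 1)
    (v w : E) : |(gaugeAt U o v + ε * gaugeAt U o (-v)) -
      (gaugeAt U o w + ε * gaugeAt U o (-w))| ≤ 2 * ‖v - w‖ / r := by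
  have h1 := h.abs_gaugeAt_sub_le v w
  have h2 := h.abs_gaugeAt_sub_le (-v) (-w)
  rw [neg_sub_neg, norm_sub_rev] at h2
  have h3 : ε * |gaugeAt U o (-v) - gaugeAt U o (-w)| ≤ 1 * (‖v - w‖ / r) :=
    mul_le_mul hε1 h2 (abs_nonneg _) zero_le_one
  calc _ = |(gaugeAt U o v - gaugeAt U o w) + ε * (gaugeAt U o (-v) - gaugeAt U o (-w))| := by
        congr 1
        ring
    _ ≤ _ := abs_add_le _ _
    _ = |gaugeAt U o v - gaugeAt U o w| + ε * |gaugeAt U o (-v) - gaugeAt U o (-w)| := by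
        rw [abs_mul, abs_of_nonneg hε]
    _ ≤ ‖v - w‖ / r + 1 * (‖v - w‖ / r) := add_le_add h1 h3
    _ = _ := by ring

theorem sphereProj_mem (h : IsPinchedDomain U o r D k K M) (hε : 0 ≤ ε) (hε1 : ε ≤ 1) {w : E}
    (hw : w ≠ 0) : sphereProj U o ε w ∈ gaugeSphere U o ε := by
  have h0 := h.gauge_add_pos hε hw
  have hc : 0 ≤ (1 - ε) / (gaugeAt U o w + ε * gaugeAt U o (-w)) :=
    div_nonneg (sub_nonneg.mpr hε1) h0.le
  change gaugeAt U o (sphereProj U o ε w - o) + ε * gaugeAt U o (o - sphereProj U o ε w) = 1 - ε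
  rw [← neg_sub (sphereProj U o ε w), sphereProj, add_sub_cancel_left, ← smul_neg,
    gaugeAt_smul hc, gaugeAt_smul hc]
  calc _ = (1 - ε) / (gaugeAt U o w + ε * gaugeAt U o (-w)) *
        (gaugeAt U o w + ε * gaugeAt U o (-w)) := by ring
    _ = _ := div_mul_cancel₀ _ h0.ne'

theorem sphereProj_smul_sub (h : IsPinchedDomain U o r D k K M) (hε : 0 ≤ ε) {x : E} {c : ℝ}
    (hc : 0 < c) (hx : x ∈ gaugeSphere U o ε) (hx0 : x ≠ o) :
    sphereProj U o ε (c • (x - o)) = x := by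
  have h1 : gaugeAt U o (x - o) + ε * gaugeAt U o (o - x) = 1 - ε := hx
  have h0 := h.gauge_add_pos hε (sub_ne_zero.mpr hx0)
  rw [neg_sub, h1] at h0
  rw [sphereProj, ← smul_neg, neg_sub, gaugeAt_smul hc.le, gaugeAt_smul hc.le, smul_smul,
    show c * gaugeAt U o (x - o) + ε * (c * gaugeAt U o (o - x)) = c * (1 - ε) by rw [← h1]; ring,
    show (1 - ε) / (c * (1 - ε)) * c = 1 by field_simp, one_smul, add_sub_cancel]

/-- Away from the unit ball the radial projection to the level set is Lipschitz, with a constant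
that does not depend on the level set. -/
theorem norm_sphereProj_sub_le (h : IsPinchedDomain U o r D k K M) (hε : 0 ≤ ε) (hε1 : ε ≤ 1)
    {v w : E} (hv : 1 ≤ ‖v‖) (hw : 1 ≤ ‖w‖) :
    ‖sphereProj U o ε v - sphereProj U o ε w‖ ≤ D * (1 + 2 * D / r) * ‖v - w‖ := by
  have hr := h.r_pos
  have hD := h.D_pos
  have h1 := h.norm_le_mul_gauge_add hε v
  have h2 := h.norm_le_mul_gauge_add hε w
  have h3 := h.abs_gauge_add_sub_le hε hε1 w v
  rw [norm_sub_rev] at h3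
  rw [sphereProj, sphereProj, add_sub_add_left_eq_sub]
  set a := gaugeAt U o v + ε * gaugeAt U o (-v)
  set b := gaugeAt U o w + ε * gaugeAt U o (-w)
  have ha : 0 < a := pos_of_mul_pos_right (zero_lt_one.trans_le (hv.trans h1)) hD.le
  have hb : 0 < b := pos_of_mul_pos_right (zero_lt_one.trans_le (hw.trans h2)) hD.le
  have ha' : a⁻¹ ≤ D := by
    rw [inv_le_iff_one_le_mul₀ ha]
    exact hv.trans h1
  have hb' : b⁻¹ * ‖w‖ ≤ D := by
    rw [inv_mul_le_iff₀ hb, mul_comm]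
    exact h2
  have key : ((1 - ε) / a) • v - ((1 - ε) / b) • w =
      (1 - ε) • (a⁻¹ • (v - w) + (a⁻¹ * (b - a)) • (b⁻¹ • w)) := by
    have : a⁻¹ * (b - a) * b⁻¹ = a⁻¹ - b⁻¹ := by field_simp
    rw [smul_smul, this, div_eq_mul_inv, div_eq_mul_inv]
    module
  rw [key, norm_smul, Real.norm_of_nonneg (sub_nonneg.mpr hε1)]
  have hx : ‖a⁻¹ • (v - w) + (a⁻¹ * (b - a)) • (b⁻¹ • w)‖ ≤
      D * ‖v - w‖ + D * (2 * ‖v - w‖ / r) * D := by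
    refine (norm_add_le _ _).trans (add_le_add ?_ ?_)
    · rw [norm_smul, Real.norm_of_nonneg (inv_nonneg.mpr ha.le)]
      gcongr
    · rw [norm_smul, norm_mul, Real.norm_of_nonneg (inv_nonneg.mpr ha.le), norm_smul,
        Real.norm_of_nonneg (inv_nonneg.mpr hb.le), Real.norm_eq_abs]
      gcongr
  calc _ ≤ 1 * (D * ‖v - w‖ + D * (2 * ‖v - w‖ / r) * D) := by
        gcongr
        linarith
    _ = _ := by ring

end norm

variable {n : ℕ}

theorem exists_net_gaugeSphere {U : Set (EuclideanSpace ℝ (Fin (n + 1)))}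
    {o : EuclideanSpace ℝ (Fin (n + 1))} {r D k K M ε : ℝ} (h : IsPinchedDomain U o r D k K M)
    (hε : 0 < ε) (hε1 : ε < 1) {m : ℕ} (hm : 0 < m) :
    ∃ s : Finset (EuclideanSpace ℝ (Fin (n + 1))), s.card ≤ 2 * (n + 1) * m ^ n ∧
      (∀ z ∈ s, z ∈ gaugeSphere U o ε) ∧
      ∀ x ∈ gaugeSphere U o ε, ∃ z ∈ s, ‖x - z‖ ≤ D * (1 + 2 * D / r) * (n + 1) / m := by
  classical
  have hr := h.r_pos
  have hD := h.D_pos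
  obtain ⟨s, hcard, hs1, hs⟩ := exists_net_cube_boundary n hm
  refine ⟨s.image (sphereProj U o ε), Finset.card_image_le.trans hcard, fun z hz => ?_,
    fun x hx => ?_⟩
  · obtain ⟨w, hw, rfl⟩ := Finset.mem_image.mp hz
    exact h.sphereProj_mem hε.le hε1.le
      (norm_pos_iff.mp (zero_lt_one.trans_le (hs1 w hw)))
  · have hx0 : x ≠ o := by
      rintro rfl
      simpa using h.gaugeAt_pos_of_mem_gaugeSphere hε1 hx
    -- Rescale `x - o` to the boundary of the cube.
    obtain ⟨i, -, hi⟩ := Finset.exists_max_image Finset.univ (fun j => |(x - o) j|)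
      Finset.univ_nonempty
    have hpos : 0 < |(x - o) i| := by
      by_contra! hle
      refine hx0 (sub_eq_zero.mp ?_)
      ext j
      exact abs_nonpos_iff.mp ((hi j (Finset.mem_univ j)).trans hle)
    set c := |(x - o) i|⁻¹ with hc
    have hc0 : 0 < c := inv_pos.mpr hpos
    have hw1 : |(c • (x - o)) i| = 1 := by
      rw [PiLp.smul_apply, smul_eq_mul, abs_mul, abs_of_pos hc0, hc, inv_mul_cancel₀ hpos.ne']
    have hw : ∀ j, |(c • (x - o)) j| ≤ 1 := fun j => by
      rw [← hw1, PiLp.smul_apply, PiLp.smul_apply, smul_eq_mul, smul_eq_mul, abs_mul, abs_mul]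
      exact mul_le_mul_of_nonneg_left (hi j (Finset.mem_univ j)) (abs_nonneg _)
    obtain ⟨z, hz, hwz⟩ := hs _ hw ⟨i, hw1⟩
    have hwn : 1 ≤ ‖c • (x - o)‖ := by
      have := PiLp.norm_apply_le (c • (x - o)) i
      rwa [Real.norm_eq_abs, hw1] at this
    refine ⟨_, Finset.mem_image_of_mem _ hz, ?_⟩
    have := h.norm_sphereProj_sub_le hε.le hε1.le hwn (hs1 z hz)
    rw [h.sphereProj_smul_sub hε.le hc0 hx hx0] at this
    calc _ ≤ _ := this
      _ ≤ D * (1 + 2 * D / r) * ((n + 1) / m) := by gcongr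
      _ = _ := by ring

/-- The measure of a level set around each point of which `U` contains chords of length `σ` pointing
to the other points. -/
theorem hausdorffVol_gaugeSphere_le {U : Set (EuclideanSpace ℝ (Fin (n + 1)))}
    {o : EuclideanSpace ℝ (Fin (n + 1))} {r D k K M ε σ : ℝ} (h : IsPinchedDomain U o r D k K M)
    (hε : 0 < ε) (hε1 : ε < 1) (hσ : 0 < σ)
    (hchord : ∀ x ∈ gaugeSphere U o ε, ∀ y ∈ gaugeSphere U o ε, ‖y - x‖ ≤ σ →
      ∀ τ : ℝ, |τ| * ‖y - x‖ ≤ σ → x + τ • (y - x) ∈ U) :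
    hausdorffVol (hilbertDist U) n (gaugeSphere U o ε) ≤
      volume (Metric.ball (0 : EuclideanSpace ℝ (Fin n)) 1) *
        ((2 * (n + 1) : ℕ) * ENNReal.ofReal (2 * (D * (1 + 2 * D / r) * (n + 1)) / σ) ^ n) := by
  have hr := h.r_pos
  have hD := h.D_pos
  set L := D * (1 + 2 * D / r) * (n + 1) with hL
  have hL0 : 0 < L := by positivity
  have hdist : ∀ x ∈ gaugeSphere U o ε, ∀ y ∈ gaugeSphere U o ε, ‖y - x‖ ≤ σ / 2 →
      hilbertDist U x y ≤ 2 * (‖y - x‖ / σ) := fun x hx y hy hxy => by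
    by_cases hne : y = x
    · simp [hne, hilbertDist]
    have hn : 0 < ‖y - x‖ := norm_pos_iff.mpr (sub_ne_zero.mpr hne)
    have hxU := h.mem_of_mem_gaugeSphere hε hx
    have hs : 0 < ‖y - x‖ / σ := by positivity
    have habs : |‖y - x‖ / σ|⁻¹ * ‖y - x‖ ≤ σ := by
      rw [abs_of_pos hs, inv_div, div_mul_cancel₀ _ hn.ne']
    refine hilbertDist_le_of_gaugeAt_le h.isOpen h.convex h.isBounded hxU ?_ ?_ ?_
    · rw [div_le_iff₀ hσ]
      linarith
    · refine ((gaugeAt_lt_iff h.isOpen h.convex hxU hs).mpr ?_).le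
      exact hchord x hx y hy (by linarith) _ (by rwa [abs_inv])
    · refine ((gaugeAt_lt_iff h.isOpen h.convex hxU hs).mpr ?_).le
      rw [← neg_sub y x, smul_neg, ← neg_smul]
      exact hchord x hx y hy (by linarith) _ (by rwa [abs_neg, abs_inv])
  refine hausdorffVol_le_of_nets (by positivity) ?_
  have hlim : ∀ᶠ m : ℕ in atTop, L / (m : ℝ) < σ / 2 :=
    (tendsto_const_div_atTop_nhds_zero_nat L).eventually (gt_mem_nhds (by positivity))
  filter_upwards [hlim, eventually_gt_atTop 0] with m hm hm0
  obtain ⟨s, hcard, hsmem, hs⟩ := h.exists_net_gaugeSphere hε hε1 hm0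
  refine ⟨s, hcard, hsmem, fun p hp => ?_⟩
  obtain ⟨z, hz, hpz⟩ := hs p hp
  refine ⟨z, hz, (hdist z (hsmem z hz) p hp (hpz.trans hm.le)).trans ?_⟩
  calc 2 * (‖p - z‖ / σ) ≤ 2 * (L / m / σ) := by gcongr
    _ = _ := by ring

/-! ### Projections of the level sets and the lower bound -/

/-- The projection of a level set contains a ball: on each line parallel to the first axis through
that ball, the intermediate value theorem gives a point of the level set. -/
theorem ball_subset_tailProj_image {U : Set (EuclideanSpace ℝ (Fin (n + 1)))}
    {o : EuclideanSpace ℝ (Fin (n + 1))} {r D k K M ε : ℝ} (h : IsPinchedDomain U o r D k K M)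
    (hε : 0 < ε) (hε1 : ε < 1) :
    Metric.ball (tailProj o) (r * (1 - ε) / 2) ⊆ tailProj '' gaugeSphere U o ε := by
  intro z hz
  rw [Metric.mem_ball, dist_eq_norm] at hz
  have hr := h.r_pos
  have hD := h.D_pos
  let J : ℝ → EuclideanSpace ℝ (Fin (n + 1)) := fun τ =>
    WithLp.toLp 2 (Fin.cons (α := fun _ => ℝ) τ fun i => (z - tailProj o) i)
  have hJ0 : ∀ τ, J τ 0 = τ := fun τ => rfl
  have hJt : ∀ τ, tailProj (J τ) = z - tailProj o := fun τ => rfl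
  have hJn : ∀ τ, ‖J τ‖ ^ 2 = τ ^ 2 + ‖z - tailProj o‖ ^ 2 := fun τ => by
    rw [norm_sq_eq_add_norm_tailProj_sq, hJ0, hJt]
  have hJc : Continuous J := by
    refine (PiLp.continuous_toLp 2 _).comp (continuous_pi fun i => ?_)
    refine Fin.cases ?_ (fun j => ?_) i
    · exact continuous_id
    · exact continuous_const
  have hcont : Continuous fun τ => gaugeAt U o (J τ) + ε * gaugeAt U o (-J τ) := by
    have := continuous_gaugeAt h.isOpen h.convex h.center_mem
    exact (this.comp hJc).add ((this.comp hJc.neg).const_mul ε)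
  have h0 : gaugeAt U o (J 0) + ε * gaugeAt U o (-J 0) ≤ 1 - ε := by
    have e1 : ‖J 0‖ = ‖z - tailProj o‖ := by
      rw [← sq_eq_sq₀ (norm_nonneg _) (norm_nonneg _), hJn]
      ring
    have e2 := h.abs_gauge_add_sub_le hε.le hε1.le (J 0) 0
    simp only [neg_zero, gaugeAt_zero, mul_zero, add_zero, sub_zero, e1] at e2
    refine ((le_abs_self _).trans e2).trans ?_
    rw [div_le_iff₀ hr]
    linarith
  have h1 : 1 - ε ≤ gaugeAt U o (J D) + ε * gaugeAt U o (-J D) := by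
    have e1 : D ≤ ‖J D‖ := by
      refine abs_le_of_sq_le_sq' ?_ (norm_nonneg _) |>.2
      rw [hJn]
      nlinarith [sq_nonneg ‖z - tailProj o‖]
    have e2 := e1.trans (h.norm_le_mul_gauge_add hε.le (J D))
    have e3 := le_of_mul_le_mul_left ((mul_one D).trans_le e2) hD
    linarith
  obtain ⟨τ, -, hτ⟩ := intermediate_value_Icc hD.le hcont.continuousOn ⟨h0, h1⟩
  refine ⟨o + J τ, ?_, ?_⟩
  · change gaugeAt U o (o + J τ - o) + ε * gaugeAt U o (o - (o + J τ)) = 1 - ε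
    rw [add_sub_cancel_left, sub_add_cancel_left]
    exact hτ
  · change tailProj o + tailProj (J τ) = z
    rw [hJt, add_sub_cancel]

theorem volume_ball_le_mul_hausdorffVol {U : Set (EuclideanSpace ℝ (Fin (n + 1)))}
    {o : EuclideanSpace ℝ (Fin (n + 1))} {r D k K M ε : ℝ} (h : IsPinchedDomain U o r D k K M)
    (hε : 0 < ε) (hε1 : ε < 1) :
    volume (Metric.ball (tailProj o) (r * (1 - ε) / 2)) ≤
      ENNReal.ofReal (5 * √(M * (1 + D / r) * D / k) * √ε) ^ n *
        hausdorffVol (hilbertDist U) n (gaugeSphere U o ε) := by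
  have hr := h.r_pos
  have hD := h.D_pos
  have hM := h.M_pos
  have hk := h.k_pos
  have hC : 0 < M * (1 + D / r) * D / k := by positivity
  refine (measure_mono (h.ball_subset_tailProj_image hε hε1)).trans
    (volume_image_le_mul_hausdorffVol (r := 1) (by positivity) one_pos ?_)
  intro x hx ρ hρ hρ1 y hy hxy
  refine (norm_tailProj_sub_le y x).trans ?_
  have hxU := h.mem_of_mem_gaugeSphere hε hx
  have hyU := h.mem_of_mem_gaugeSphere hε hy
  obtain ⟨h1, h2⟩ := gaugeAt_le_of_hilbertDist_le h.isOpen h.convex h.isBounded hxU hyU hρ.le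
    (by linarith) hxy
  -- The gauge at `x` is at most `4 ρ`; the factor `5` makes the inequality strict.
  have h5 : 0 < 5 * ρ := by positivity
  have h3 := (gaugeAt_lt_iff h.isOpen h.convex hxU h5).mp (h1.trans_lt (by linarith))
  have h4 := (gaugeAt_lt_iff h.isOpen h.convex hxU h5).mp (h2.trans_lt (by linarith))
  rw [← neg_sub y x, smul_neg, ← sub_eq_add_neg] at h4
  have h6 := h.mul_norm_sq_le_of_add_mem_of_sub_mem hε hε1 hx h3 h4
  rw [norm_smul, norm_inv, Real.norm_of_nonneg h5.le] at h6
  have h7 : ((5 * ρ)⁻¹ * ‖y - x‖) ^ 2 ≤ M * (1 + D / r) * D / k * ε := by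
    rw [div_mul_eq_mul_div, le_div_iff₀ hk]
    linarith
  have h8 := Real.le_sqrt_of_sq_le h7
  rw [Real.sqrt_mul hC.le, inv_mul_le_iff₀ h5] at h8
  linarith

end IsPinchedDomain

/-! ### Growth of the volume of spheres -/

theorem exists_isPinchedDomain {n : ℕ} {U : Set (EuclideanSpace ℝ (Fin n))} (hU : IsOpen U)
    (hconv : Convex ℝ U) (hbdd : Bornology.IsBounded U) (hb : HasC3PositivelyCurvedBoundary U)
    {o : EuclideanSpace ℝ (Fin n)} (ho : o ∈ U) :
    ∃ r D k K M : ℝ, IsPinchedDomain U o r D k K M := by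
  obtain ⟨k, K, M, hk, hK, hM, hsupp⟩ :=
    exists_isPinchedSupportAt_of_hasC3PositivelyCurvedBoundary hU hconv hbdd hb
  obtain ⟨r, hr, hball⟩ := Metric.isOpen_iff.mp hU o ho
  obtain ⟨D, hD⟩ := Metric.isBounded_iff.mp hbdd
  exact ⟨r, max D 1, k, K, M, hU, hconv, hr, by positivity, hk, hK, hM, hball, fun x hx y hy => by
    rw [← dist_eq_norm]
    exact (hD hx hy).trans (le_max_left _ _), hsupp⟩

theorem sqrt_exp_neg_two_mul (t : ℝ) : √(Real.exp (-(2 * t))) = Real.exp (-t) := by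
  rw [← Real.exp_half]
  congr 1
  ring

namespace IsPinchedDomain

variable {n : ℕ} {U : Set (EuclideanSpace ℝ (Fin (n + 1)))} {o : EuclideanSpace ℝ (Fin (n + 1))}
  {r D k K M ε : ℝ}

theorem hausdorffVol_gaugeSphere_pos (h : IsPinchedDomain U o r D k K M) (hε : 0 < ε)
    (hε1 : ε < 1) : 0 < hausdorffVol (hilbertDist U) n (gaugeSphere U o ε) := by
  have h1 := h.volume_ball_le_mul_hausdorffVol hε hε1
  have h2 : 0 < r * (1 - ε) / 2 := by
    have := h.r_pos
    have : 0 < 1 - ε := by linarith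
    positivity
  have h3 := (Metric.measure_ball_pos volume (tailProj o) h2).trans_le h1
  exact pos_iff_ne_zero.mpr fun h0 => by simp [h0] at h3

theorem hausdorffVol_gaugeSphere_lt_top (h : IsPinchedDomain U o r D k K M) (hε : 0 < ε)
    (hε1 : ε < 1) : hausdorffVol (hilbertDist U) n (gaugeSphere U o ε) < ∞ := by
  have hr := h.r_pos
  -- The ball of radius `ε r` about any point of the level set lies in `U`.
  refine (h.hausdorffVol_gaugeSphere_le (σ := ε * r / 2) hε hε1 (by positivity)
    fun x hx y hy _ τ hτ => ?_).trans_lt ?_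
  · have h1 := h.abs_gaugeAt_sub_le (x + τ • (y - x) - o) (x - o)
    rw [sub_sub_sub_cancel_right, add_sub_cancel_left, norm_smul, Real.norm_eq_abs] at h1
    have h2 : |τ| * ‖y - x‖ / r ≤ ε / 2 := by
      rw [div_le_iff₀ hr]
      linarith
    have h3 := (h.one_sub_gaugeAt_bounds hε hx).1
    have h4 : gaugeAt U o (x + τ • (y - x) - o) < 1 := by
      linarith [le_abs_self (gaugeAt U o (x + τ • (y - x) - o) - gaugeAt U o (x - o))]
    rw [gaugeAt_lt_one_iff h.isOpen h.convex h.center_mem] at h4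
    simpa using h4
  · exact ENNReal.mul_lt_top measure_ball_lt_top (ENNReal.mul_lt_top (ENNReal.natCast_lt_top _)
      (ENNReal.pow_lt_top ENNReal.ofReal_lt_top))

theorem exists_exp_le_hausdorffVol (h : IsPinchedDomain U o r D k K M) :
    ∃ c : ℝ, 0 < c ∧ ∀ t : ℝ, 1 ≤ t → c * Real.exp (n * t) ≤
      (hausdorffVol (hilbertDist U) n (gaugeSphere U o (Real.exp (-(2 * t))))).toReal := by
  have hr := h.r_pos
  have hD := h.D_pos
  have hM := h.M_pos
  have hk := h.k_pos
  set L := 5 * √(M * (1 + D / r) * D / k) with hL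
  have hL0 : 0 < L := by positivity
  set v := (volume (Metric.ball (tailProj o) (r / 4))).toReal with hv
  have hv0 : 0 < v := ENNReal.toReal_pos (Metric.measure_ball_pos volume _ (by positivity)).ne'
    measure_ball_lt_top.ne
  refine ⟨v / L ^ n, by positivity, fun t ht => ?_⟩
  have hε : 0 < Real.exp (-(2 * t)) := Real.exp_pos _
  have hε2 : Real.exp (-(2 * t)) ≤ 1 / 2 := by
    have e1 : 2 * t + 1 ≤ Real.exp (2 * t) := Real.add_one_le_exp _
    rw [Real.exp_neg, one_div]
    exact inv_anti₀ two_pos (by linarith)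
  have hε1 : Real.exp (-(2 * t)) < 1 := by linarith
  have h1 := h.volume_ball_le_mul_hausdorffVol hε hε1
  have h2 : volume (Metric.ball (tailProj o) (r / 4)) ≤
      volume (Metric.ball (tailProj o) (r * (1 - Real.exp (-(2 * t))) / 2)) :=
    measure_mono (Metric.ball_subset_ball (by nlinarith))
  have h3 := ENNReal.toReal_mono (ENNReal.mul_ne_top (ENNReal.pow_ne_top ENNReal.ofReal_ne_top)
    (h.hausdorffVol_gaugeSphere_lt_top hε hε1).ne) (h2.trans h1)
  rw [sqrt_exp_neg_two_mul, ENNReal.toReal_mul, ENNReal.toReal_pow,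
    ENNReal.toReal_ofReal (by positivity), ← hL, mul_pow, ← Real.exp_nat_mul, mul_neg,
    Real.exp_neg] at h3
  have he := Real.exp_pos (n * t)
  calc v / L ^ n * Real.exp (n * t) ≤ (L ^ n * (Real.exp (n * t))⁻¹ * _) / L ^ n *
        Real.exp (n * t) := by gcongr
    _ = _ := by field_simp

theorem exists_hausdorffVol_le_exp (h : IsPinchedDomain U o r D k K M) :
    ∃ C T : ℝ, 0 < C ∧ ∀ t : ℝ, T ≤ t →
      (hausdorffVol (hilbertDist U) n (gaugeSphere U o (Real.exp (-(2 * t))))).toReal ≤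
        C * Real.exp (n * t) := by
  have hr := h.r_pos
  have hD := h.D_pos
  obtain ⟨c, ε₀, hc, hε0, hε1, hchord⟩ := h.exists_add_smul_mem
  set L := 2 * (D * (1 + 2 * D / r) * (n + 1)) with hL
  have hL0 : 0 < L := by positivity
  set v := (volume (Metric.ball (0 : EuclideanSpace ℝ (Fin n)) 1)).toReal with hv
  have hv0 : 0 < v := ENNReal.toReal_pos (Metric.measure_ball_pos volume _ one_pos).ne'
    measure_ball_lt_top.ne
  refine ⟨v * ((2 * (n + 1) : ℕ) * (L / c) ^ n), -Real.log ε₀ / 2, by positivity, fun t ht => ?_⟩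
  have hε : 0 < Real.exp (-(2 * t)) := Real.exp_pos _
  have hεle : Real.exp (-(2 * t)) ≤ ε₀ := by
    rw [← Real.le_log_iff_exp_le hε0]
    linarith
  have hεlt : Real.exp (-(2 * t)) < 1 := hεle.trans_lt hε1
  have h1 := h.hausdorffVol_gaugeSphere_le hε hεlt (by positivity) (hchord _ hε hεle)
  have h2 := ENNReal.toReal_mono (ENNReal.mul_ne_top measure_ball_lt_top.ne
    (ENNReal.mul_ne_top (ENNReal.natCast_ne_top _) (ENNReal.pow_ne_top ENNReal.ofReal_ne_top))) h1
  rw [sqrt_exp_neg_two_mul, ENNReal.toReal_mul, ENNReal.toReal_mul, ENNReal.toReal_natCast,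
    ENNReal.toReal_pow, ENNReal.toReal_ofReal (by positivity), ← hL, ← hv] at h2
  refine h2.trans (le_of_eq ?_)
  have e1 : L / (c * Real.exp (-t)) = L / c * Real.exp t := by
    rw [Real.exp_neg]
    field_simp
  rw [e1, mul_pow, ← Real.exp_nat_mul]
  ring

end IsPinchedDomain

/-- A positive function that is `e^{at}` up to bounded factors has exponential growth rate `a`. -/
theorem tendsto_log_div_of_exp_bounds {V : ℝ → ℝ} {a c C : ℝ} (hc : 0 < c) (hC : 0 < C)
    (h1 : ∀ᶠ t in atTop, c * Real.exp (a * t) ≤ V t)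
    (h2 : ∀ᶠ t in atTop, V t ≤ C * Real.exp (a * t)) :
    Tendsto (fun t => Real.log (V t) / t) atTop (𝓝 a) := by
  have hlim : ∀ b : ℝ, Tendsto (fun t : ℝ => a + Real.log b / t) atTop (𝓝 a) := fun b => by
    simpa using (tendsto_const_nhds (x := a)).add
      ((tendsto_const_nhds (x := Real.log b)).div_atTop tendsto_id)
  have hlog : ∀ b t : ℝ, 0 < b → 0 < t →
      Real.log (b * Real.exp (a * t)) / t = a + Real.log b / t := fun b t hb ht => by
    rw [Real.log_mul hb.ne' (Real.exp_pos _).ne', Real.log_exp]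
    field_simp
    ring
  refine tendsto_of_tendsto_of_tendsto_of_le_of_le' (hlim c) (hlim C) ?_ ?_
  · filter_upwards [h1, eventually_gt_atTop 0] with t ht ht0
    rw [← hlog c t hc ht0]
    have : 0 < c * Real.exp (a * t) := by positivity
    gcongr
  · filter_upwards [h1, h2, eventually_gt_atTop 0] with t ht ht' ht0
    rw [← hlog C t hC ht0]
    have : 0 < c * Real.exp (a * t) := by positivity
    have : 0 < V t := this.trans_le ht
    gcongr

theorem theorem1 (n : ℕ) (U : Set (EuclideanSpace ℝ (Fin (n + 1))))
    (hU_open : IsOpen U) (hU_convex : Convex ℝ U) (hU_bdd : Bornology.IsBounded U)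
    (hU_bdry : HasC3PositivelyCurvedBoundary U)
    (o : EuclideanSpace ℝ (Fin (n + 1))) (ho : o ∈ U) :
    (∀ t : ℝ, 0 < t →
      0 < hausdorffVol (hilbertDist U) n (hilbertSphere U o t) ∧
        hausdorffVol (hilbertDist U) n (hilbertSphere U o t) < ∞) ∧
    Tendsto
      (fun t : ℝ =>
        Real.log (hausdorffVol (hilbertDist U) n (hilbertSphere U o t)).toReal / t)
      atTop (𝓝 (n : ℝ)) := by
  obtain ⟨r, D, k, K, M, h⟩ := exists_isPinchedDomain hU_open hU_convex hU_bdd hU_bdry ho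
  simp only [hilbertSphere_eq_gaugeSphere hU_open hU_convex hU_bdd ho]
  refine ⟨fun t ht => ?_, ?_⟩
  · have hε1 : Real.exp (-(2 * t)) < 1 :=
      Real.exp_lt_one_iff.mpr (by linarith)
    exact ⟨h.hausdorffVol_gaugeSphere_pos (Real.exp_pos _) hε1,
      h.hausdorffVol_gaugeSphere_lt_top (Real.exp_pos _) hε1⟩
  · obtain ⟨c, hc, hlow⟩ := h.exists_exp_le_hausdorffVol
    obtain ⟨C, T, hC, hupp⟩ := h.exists_hausdorffVol_le_exp
    exact tendsto_log_div_of_exp_bounds hc hC ((eventually_ge_atTop 1).mono hlow)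
      ((eventually_ge_atTop T).mono hupp)
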